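/- **Setting.** Let $n\ge 1$ and let $\mathbb F_{2^n}$ be represented by a polynomial basis $1,x,\dots,x^{n-1}$ over $\mathbb F_2$; a field element is stored in a register of $n$ qubits, one for each coordinate. Circuits are finite sequences of gates from the set consisting of CNOT and the one-qubit gates $X,Y,Z,H,S,S^\dagger,T,T^\dagger$. The depth of a circuit is the length of a longest path in its dependency graph (gates on disjoint wires are executed in parallel), the $T$-depth is the maximal number of $T$- and $T^\dagger$-gates on such a path, and $T$- and $T^\dagger$-gates are both counted as $T$-gates. A circuit may use ancilla qubits, which start in $|0\rangle$ and must be returned to $|0\rangle$. Let $d_1,d_2\in\mathbb F_{2^n}$ with $d_1\neq 0$ and $\operatorname{Tr}(d_2)=1$, and let $E_{\mathrm B,d_1,d_2}$ be the complete binary Edwards curve, that is, the affine curve $$d_1(x+y)+d_2(x^2+y^2)=xy+xy(x+y)+x^2y^2 .$$ The sum of two $\mathbb F_{2^n}$-rational points $P_1=(x_1,y_1)$ and $P_2=(x_2,y_2)$ of the curve is the point $P_1+P_2=(x_3,y_3)$ of the curve with $$x_3=\frac{d_1(x_1+x_2)+d_2(x_1+y_1)(x_2+y_2)+(x_1+x_1^2)(x_2(y_1+y_2+1)+y_1y_2)}{d_1+(x_1+x_1^2)(x_2+y_2)},$$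 $$y_3=\frac{d_1(y_1+y_2)+d_2(x_1+y_1)(x_2+y_2)+(y_1+y_1^2)(y_2(x_1+x_2+1)+x_1x_2)}{d_1+(y_1+y_1^2)(x_2+y_2)},$$ where the denominators never vanish. A projective representation of a point $(x,y)$ is a triple $(X,Y,Z)\in\mathbb F_{2^n}^3$ with $Z\ne0$, $X/Z=x$ and $Y/Z=y$. Let a multiplier be given, that is, a circuit that maps $|\alpha\rangle|\beta\rangle|\xi\rangle$ to $|\alpha\rangle|\beta\rangle|\xi+\alpha\beta\rangle$ for all $\alpha,\beta,\xi\in\mathbb F_{2^n}$ (including the clean-up of its ancillae). Let $D_M(n)$ be its depth, $G_M(n)$ its number of gates, $D_M^T(n)$ its $T$-depth and $G_M^T(n)$ its number of $T$-gates. **Proposition.** There is a single circuit which, for all (not necessarily distinct) rational points $P_1,P_2$ of $E_{\mathrm B,d_1,d_2}$ and all projective representations $(X_1,Y_1,Z_1)$ of $P_1$ and $(X_2,Y_2,Z_2)$ of $P_2$, maps $$|X_1\rangle|Y_1\rangle|Z_1\rangle|X_2\rangle|Y_2\rangle|Z_2\rangle|0\rangle|0\rangle|0\rangle\longmapsto|X_1\rangle|Y_1\rangle|Z_1\rangle|X_2\rangle|Y_2\rangle|Z_2\rangle|X_3\rangle|Y_3\rangle|Z_3\rangle$$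 where $(X_3,Y_3,Z_3)$ is a projective representation of $P_1+P_2$, including the clean-up of ancillae, such that * its depth is at most $5D_M(n)+4\max(D_M(n),2n)+O(1)$; * its $T$-depth is at most $9D_M^T(n)$; * its number of gates is at most $39G_M(n)+8n^2+O(n)$; * its number of $T$-gates is $39G_M^T(n)$. The constants in $O(1)$ and $O(n)$ are absolute: they depend neither on $n$, the field representation and the curve nor on the multiplier. Moreover, the summands $2n$ and $O(1)$ of the depth and $8n^2+O(n)$ of the number of gates reflect CNOT gates only. In precise terms: let each kind of gate be given a weight in $\mathbb Z_{\ge0}$, a gate and its inverse having the same weight, and let $w$ be the weight of CNOT. Let $D$ and $G$ be the maximal weight of a path in the multiplier and the total weight of its gates. Then, with the same circuit and the same constants, the maximal weight of a path is at most $5D+4\max(D,2nw)+O(1)\cdot w$, and the total weight of the gates is at most $39G+(8n^2+O(n))\cdot w$. -/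

import Mathlib

open scoped BigOperators

/-! ## Clifford+T circuits on qubits -/

/-- The one-qubit gates: Pauli gates, Hadamard gate, phase gate `S` and `T`-gate with
their adjoints. -/
inductive OneQubit where
  | X | Y | Z | H | S | Sdg | T | Tdg
  deriving DecidableEq

namespace OneQubit

/-- The unitary matrix of a one-qubit gate in the computational basis. -/
noncomputable def mat : OneQubit → Matrix (ZMod 2) (ZMod 2) ℂ
  | X => !![0, 1; 1, 0]
  | Y => !![0, -Complex.I; Complex.I, 0]
  | Z => !![1, 0; 0, -1]
  | H => ((Real.sqrt 2 : ℝ) : ℂ)⁻¹ • !![1, 1; 1, -1]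
  | S => !![1, 0; 0, Complex.I]
  | Sdg => !![1, 0; 0, -Complex.I]
  | T => !![1, 0; 0, Complex.exp (Complex.I * Real.pi / 4)]
  | Tdg => !![1, 0; 0, Complex.exp (-(Complex.I * Real.pi / 4))]

/-- The kind of the inverse gate. -/
def adj : OneQubit → OneQubit
  | X => X
  | Y => Y
  | Z => Z
  | H => H
  | S => Sdg
  | Sdg => S
  | T => Tdg
  | Tdg => T

/-- `1` for `T` and its adjoint, `0` for all Clifford gates. -/
def tWeight : OneQubit → ℕ
  | T => 1
  | Tdg => 1
  | _ => 0

end OneQubit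

/-- A gate on qubits labelled by `ι`: a one-qubit gate on wire `q`, or a CNOT with control `c`
and target `t`. -/
inductive Gate (ι : Type*) where
  | one (u : OneQubit) (q : ι) : Gate ι
  | cnot (c t : ι) (h : c ≠ t) : Gate ι

/-- A pure state vector on the qubits labelled by `ι`, as its family of amplitudes. -/
abbrev QState (ι : Type*) := (ι → ZMod 2) → ℂ

/-- The computational basis state `|b⟩`. -/
def ket {ι : Type*} [Fintype ι] (b : ι → ZMod 2) : QState ι := fun b' => if b' = b then 1 else 0

namespace Gate

variable {ι : Type*}

/-- The wires that a gate acts on. -/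
def wires : Gate ι → Set ι
  | one _ q => {q}
  | cnot c t _ => {c, t}

/-- The action of a gate on state vectors; CNOT maps `|b⟩` to `|b'⟩`, where `b'` is `b` with the
target bit replaced by target plus control. -/
noncomputable def apply [DecidableEq ι] : Gate ι → QState ι → QState ι
  | one u q, ψ => fun b => ∑ v : ZMod 2, u.mat (b q) v * ψ (Function.update b q v)
  | cnot c t _, ψ => fun b => ψ (Function.update b t (b t + b c))

/-- The weight of a gate, when one-qubit gates are weighted by `w` and CNOT gates by `wC`. -/
def weight (w : OneQubit → ℕ) (wC : ℕ) : Gate ι → ℕ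
  | one u _ => w u
  | cnot _ _ _ => wC

/-- Two gates share a wire, so that their order matters for the depth. -/
def Share (g h : Gate ι) : Prop := (g.wires ∩ h.wires).Nonempty

end Gate

/-- A circuit: a finite sequence of gates, applied from left to right. -/
abbrev Circuit (ι : Type*) := List (Gate ι)

namespace Circuit

variable {ι : Type*}

/-- The action of a circuit on state vectors. -/
noncomputable def run [DecidableEq ι] (C : Circuit ι) (ψ : QState ι) : QState ι :=
  C.foldl (fun φ g => g.apply φ) ψ

/-- The total weight of all gates. -/
def size (w : OneQubit → ℕ) (wC : ℕ) (C : Circuit ι) : ℕ := (C.map (Gate.weight w wC)).sum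

/-- The total weight of a heaviest path in the dependency graph of the circuit: a path is a
subsequence of the gates in which any two consecutive gates share a wire. If the weights are
durations, this is the least total duration of the circuit with gates on disjoint wires executed
in parallel. -/
noncomputable def span (w : OneQubit → ℕ) (wC : ℕ) (C : Circuit ι) : ℕ :=
  sSup {s | ∃ p : List (Gate ι), p.Sublist C ∧ p.IsChain Gate.Share ∧
    s = (p.map (Gate.weight w wC)).sum}

/-- The number of gates. -/
def gateCount (C : Circuit ι) : ℕ := C.length

/-- The number of `T`-gates (including adjoints). -/
def tCount (C : Circuit ι) : ℕ := C.size OneQubit.tWeight 0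

/-- The depth: every gate takes one time step. -/
noncomputable def depth (C : Circuit ι) : ℕ := C.span (fun _ => 1) 1

/-- The `T`-depth: only `T`-gates (including adjoints) take a time step, Clifford gates are free. -/
noncomputable def tDepth (C : Circuit ι) : ℕ := C.span OneQubit.tWeight 0

/-- The supremum in the definition of `span` is over a bounded non-empty set. -/
theorem span_le_iff (w : OneQubit → ℕ) (wC : ℕ) (C : Circuit ι) (m : ℕ) :
    C.span w wC ≤ m ↔ ∀ p : List (Gate ι), p.Sublist C → p.IsChain Gate.Share →
      (p.map (Gate.weight w wC)).sum ≤ m := by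
  constructor
  · intro h p hp hc
    have hb : BddAbove {s | ∃ p : List (Gate ι), p.Sublist C ∧ p.IsChain Gate.Share ∧
        s = (p.map (Gate.weight w wC)).sum} := by
      refine ⟨(C.map (Gate.weight w wC)).sum, ?_⟩
      rintro s ⟨q, hq, -, rfl⟩
      exact (hq.map _).sum_le_sum (fun _ _ => Nat.zero_le _)
    exact le_trans (le_csSup hb ⟨p, hp, hc, rfl⟩) h
  · intro h
    refine csSup_le ⟨0, [], List.nil_sublist _, List.IsChain.nil, rfl⟩ ?_
    rintro s ⟨q, hq, hc, rfl⟩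
    exact h q hq hc

end Circuit

/-! ## Registers holding field elements -/

/-- `r` registers of `n` qubits each, and `a` ancilla qubits. -/
abbrev Wire (r n a : ℕ) := (Fin r × Fin n) ⊕ Fin a

/-- The bit string of `r` registers holding the coordinates of the field elements `v 0, v 1, …`
with respect to a polynomial basis `1, x, …, x ^ (n - 1)`, and `a` ancilla bits equal to `0`. -/
noncomputable def encode {F : Type*} [Field F] [Algebra (ZMod 2) F] (pb : PowerBasis (ZMod 2) F)
    {r : ℕ} (a : ℕ) (v : Fin r → F) : Wire r pb.dim a → ZMod 2
  | Sum.inl (i, j) => pb.basis.repr (v i) j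
  | Sum.inr _ => 0

/-- `M` is a multiplier `|α⟩|β⟩|ξ⟩ ↦ |α⟩|β⟩|ξ + αβ⟩`; its ancilla qubits start in `|0⟩` and are
returned to `|0⟩`. -/
def IsMultiplier {F : Type*} [Field F] [Algebra (ZMod 2) F] (pb : PowerBasis (ZMod 2) F)
    {a : ℕ} (M : Circuit (Wire 3 pb.dim a)) : Prop :=
  ∀ α β ξ : F, M.run (ket (encode pb a ![α, β, ξ])) = ket (encode pb a ![α, β, ξ + α * β])

/-! ## Complete binary Edwards curves -/

section EdwardsIdentities

variable {R : Type*} [CommRing R] [CharP R 2]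

set_option maxHeartbeats 1000000 in
set_option maxRecDepth 100000 in
theorem edwards_identity_sum (d₁ d₂ x₁ y₁ x₂ y₂ U V X Y : R)
    (h₁ : d₁ * (x₁ + y₁) + d₂ * (x₁ ^ 2 + y₁ ^ 2) = x₁ * y₁ + x₁ * y₁ * (x₁ + y₁) + x₁ ^ 2 * y₁ ^ 2)
    (hU : U = d₁ + (x₁ + x₁ ^ 2) * (x₂ + y₂)) (hV : V = d₁ + (y₁ + y₁ ^ 2) * (x₂ + y₂))
    (hX : X = d₁ * (x₁ + x₂) + d₂ * (x₁ + y₁) * (x₂ + y₂) +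
      (x₁ + x₁ ^ 2) * (x₂ * (y₁ + y₂ + 1) + y₁ * y₂))
    (hY : Y = d₁ * (y₁ + y₂) + d₂ * (x₁ + y₁) * (x₂ + y₂) +
      (y₁ + y₁ ^ 2) * (y₂ * (x₁ + x₂ + 1) + x₁ * x₂)) :
    X * V + Y * U = d₁ * ((x₁ + x₁ ^ 2) * (x₂ + x₂ ^ 2) + (y₁ + y₁ ^ 2) * (y₂ + y₂ ^ 2) +
      d₁ * (x₁ + y₁ + x₂ + y₂)) := by
  subst hU hV hX hY
  grind

/-- The cofactor that occurs in the verification of the addition law. -/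
def edwardsCofactor (d₁ d₂ x₁ y₁ x₂ y₂ : R) : R :=
  x₁ * x₂ + x₁ * x₂ ^ 2 + x₁ * y₁ * y₂ + x₁ * y₁ * y₂ ^ 2 + x₁ * y₁ * x₂ + x₁ * y₁ * x₂ ^ 2 +
    x₁ ^ 2 * y₂ ^ 2 + x₁ ^ 2 * x₂ + x₁ ^ 2 * y₁ * y₂ + x₁ ^ 2 * y₁ * y₂ ^ 2 +
    x₁ ^ 2 * y₁ * x₂ + x₁ ^ 2 * y₁ * x₂ ^ 2 + x₁ ^ 3 * y₂ + x₁ ^ 3 * y₂ ^ 2 + x₁ ^ 3 * x₂ +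
    x₁ ^ 3 * x₂ ^ 2 + x₁ ^ 4 * y₂ + x₁ ^ 4 * x₂ + d₂ * y₁ * y₂ + d₂ * y₁ * y₂ ^ 2 +
    d₂ * y₁ * x₂ + d₂ * y₁ * x₂ ^ 2 + d₂ * x₁ * y₂ + d₂ * x₁ * y₂ ^ 2 + d₂ * x₁ * x₂ +
    d₂ * x₁ * x₂ ^ 2 + d₁ * x₂ + d₁ * x₂ ^ 2 + d₁ * x₁ + d₁ * x₁ ^ 2

set_option maxHeartbeats 1000000 in
set_option maxRecDepth 100000 in
theorem edwards_identity_fst (d₁ d₂ x₁ y₁ x₂ y₂ U X : R)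
    (h₁ : d₁ * (x₁ + y₁) + d₂ * (x₁ ^ 2 + y₁ ^ 2) = x₁ * y₁ + x₁ * y₁ * (x₁ + y₁) + x₁ ^ 2 * y₁ ^ 2)
    (h₂ : d₁ * (x₂ + y₂) + d₂ * (x₂ ^ 2 + y₂ ^ 2) = x₂ * y₂ + x₂ * y₂ * (x₂ + y₂) + x₂ ^ 2 * y₂ ^ 2)
    (hU : U = d₁ + (x₁ + x₁ ^ 2) * (x₂ + y₂))
    (hX : X = d₁ * (x₁ + x₂) + d₂ * (x₁ + y₁) * (x₂ + y₂) +
      (x₁ + x₁ ^ 2) * (x₂ * (y₁ + y₂ + 1) + y₁ * y₂)) :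
    X * (X + U) = d₁ * edwardsCofactor d₁ d₂ x₁ y₁ x₂ y₂ := by
  unfold edwardsCofactor
  subst hU hX
  grind

set_option maxHeartbeats 4000000 in
set_option maxRecDepth 100000 in
theorem edwards_identity_prod (d₁ d₂ x₁ y₁ x₂ y₂ U V W : R)
    (h₁ : d₁ * (x₁ + y₁) + d₂ * (x₁ ^ 2 + y₁ ^ 2) = x₁ * y₁ + x₁ * y₁ * (x₁ + y₁) + x₁ ^ 2 * y₁ ^ 2)
    (h₂ : d₁ * (x₂ + y₂) + d₂ * (x₂ ^ 2 + y₂ ^ 2) = x₂ * y₂ + x₂ * y₂ * (x₂ + y₂) + x₂ ^ 2 * y₂ ^ 2)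
    (hU : U = d₁ + (x₁ + x₁ ^ 2) * (x₂ + y₂)) (hV : V = d₁ + (y₁ + y₁ ^ 2) * (x₂ + y₂))
    (hW : W = (x₁ + x₁ ^ 2) * (x₂ + x₂ ^ 2) + (y₁ + y₁ ^ 2) * (y₂ + y₂ ^ 2) +
      d₁ * (x₁ + y₁ + x₂ + y₂)) :
    U * V * W + d₂ * W ^ 2 =
      edwardsCofactor d₁ d₂ x₁ y₁ x₂ y₂ * edwardsCofactor d₁ d₂ y₁ x₁ y₂ x₂ := by
  unfold edwardsCofactor
  subst hU hV hW
  grind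

end EdwardsIdentities

/-- The coefficients of a complete binary Edwards curve over a finite field of characteristic
two: `d₁ ≠ 0`, and `d₂` has absolute trace `1`. -/
structure EdwardsCurve (F : Type*) [Field F] [Algebra (ZMod 2) F] where
  d₁ : F
  d₂ : F
  d₁_ne_zero : d₁ ≠ 0
  trace_d₂ : Algebra.trace (ZMod 2) F d₂ = 1

namespace EdwardsCurve

variable {F : Type*} [Field F] [Algebra (ZMod 2) F] (E : EdwardsCurve F)

/-- The equation of the curve. -/
def Equation (x y : F) : Prop :=
  E.d₁ * (x + y) + E.d₂ * (x ^ 2 + y ^ 2) = x * y + x * y * (x + y) + x ^ 2 * y ^ 2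

/-- The rational points of the (affine) curve. -/
@[ext]
structure Point where
  x : F
  y : F
  equation : E.Equation x y

/-- The numerator of the first coordinate of a sum; the one of the second coordinate arises by
exchanging `x` and `y`. -/
def num (x₁ y₁ x₂ y₂ : F) : F :=
  E.d₁ * (x₁ + x₂) + E.d₂ * (x₁ + y₁) * (x₂ + y₂) +
    (x₁ + x₁ ^ 2) * (x₂ * (y₁ + y₂ + 1) + y₁ * y₂)

/-- The denominator of the first coordinate of a sum; the one of the second coordinate arises by
exchanging `x` and `y`. -/
def den (x₁ x₂ y₂ : F) : F := E.d₁ + (x₁ + x₁ ^ 2) * (x₂ + y₂)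

/-- `d₂` is not of the form `t ^ 2 + t`, by its trace. -/
theorem d₂_ne [Module.Finite (ZMod 2) F] (t : F) : E.d₂ ≠ t ^ 2 + t := by
  intro h
  have : CharP F 2 := charP_of_injective_algebraMap (algebraMap (ZMod 2) F).injective 2
  have : Finite F := Module.finite_of_finite (ZMod 2)
  have hf : Algebra.trace (ZMod 2) F (t ^ 2) = Algebra.trace (ZMod 2) F t := by
    have := Fintype.ofFinite F
    have h := Algebra.trace_eq_of_algEquiv (FiniteField.frobeniusAlgEquivOfAlgebraic (ZMod 2) F) t
    simpa using h
  have h1 := E.trace_d₂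
  rw [h, map_add, hf, CharTwo.add_self_eq_zero] at h1
  exact zero_ne_one h1

/-- The denominators of the addition law never vanish. -/
theorem den_ne_zero [Module.Finite (ZMod 2) F] (x₁ : F) {x₂ y₂ : F} (h₂ : E.Equation x₂ y₂) :
    E.den x₁ x₂ y₂ ≠ 0 := by
  intro h
  have : CharP F 2 := charP_of_injective_algebraMap (algebraMap (ZMod 2) F).injective 2
  have h0 := E.d₁_ne_zero
  unfold den at h
  unfold Equation at h₂
  have hw : x₂ + y₂ ≠ 0 := by
    intro hw
    rw [hw, mul_zero, add_zero] at h
    exact h0 h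
  refine E.d₂_ne (x₁ + x₂ + (x₂ + x₂ ^ 2) / (x₂ + y₂)) ?_
  have h2 : (2 : F) = 0 := CharTwo.two_eq_zero
  generalize hq : (x₂ + x₂ ^ 2) / (x₂ + y₂) = q
  rw [div_eq_iff hw] at hq
  have key : (x₂ + y₂) ^ 2 * (E.d₂ - ((x₁ + x₂ + q) ^ 2 + (x₁ + x₂ + q))) = 0 := by
    grind
  rcases mul_eq_zero.1 key with h' | h'
  · exact absurd (pow_eq_zero_iff (two_ne_zero) |>.1 h') hw
  · exact sub_eq_zero.1 h'

theorem equation_symm {x y : F} (h : E.Equation x y) : E.Equation y x := by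
  unfold Equation at *
  linear_combination h

/-- The sum of two points of the curve lies on the curve. -/
theorem equation_add [Module.Finite (ZMod 2) F] {x₁ y₁ x₂ y₂ : F} (h₁ : E.Equation x₁ y₁)
    (h₂ : E.Equation x₂ y₂) :
    E.Equation (E.num x₁ y₁ x₂ y₂ / E.den x₁ x₂ y₂) (E.num y₁ x₁ y₂ x₂ / E.den y₁ x₂ y₂) := by
  have : CharP F 2 := charP_of_injective_algebraMap (algebraMap (ZMod 2) F).injective 2
  have hU := E.den_ne_zero x₁ h₂
  have hV := E.den_ne_zero y₁ h₂
  have hV' : E.den y₁ x₂ y₂ = E.den y₁ y₂ x₂ := by unfold den; ring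
  have i1 := edwards_identity_sum E.d₁ E.d₂ x₁ y₁ x₂ y₂ (E.den x₁ x₂ y₂) (E.den y₁ x₂ y₂)
    (E.num x₁ y₁ x₂ y₂) (E.num y₁ x₁ y₂ x₂) h₁ rfl rfl rfl (by unfold num; ring)
  have i2 := edwards_identity_fst E.d₁ E.d₂ x₁ y₁ x₂ y₂ (E.den x₁ x₂ y₂)
    (E.num x₁ y₁ x₂ y₂) h₁ h₂ rfl rfl
  have i3 := edwards_identity_fst E.d₁ E.d₂ y₁ x₁ y₂ x₂ (E.den y₁ x₂ y₂)
    (E.num y₁ x₁ y₂ x₂) (E.equation_symm h₁) (E.equation_symm h₂) hV' rfl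
  have i4 := edwards_identity_prod E.d₁ E.d₂ x₁ y₁ x₂ y₂ (E.den x₁ x₂ y₂) (E.den y₁ x₂ y₂) _
    h₁ h₂ rfl rfl rfl
  unfold Equation
  generalize E.den x₁ x₂ y₂ = U at *
  generalize E.den y₁ x₂ y₂ = V at *
  generalize E.num x₁ y₁ x₂ y₂ = X at *
  generalize E.num y₁ x₁ y₂ x₂ = Y at *
  generalize edwardsCofactor E.d₁ E.d₂ x₁ y₁ x₂ y₂ = A at *
  generalize edwardsCofactor E.d₁ E.d₂ y₁ x₁ y₂ x₂ = B at *
  generalize (x₁ + x₁ ^ 2) * (x₂ + x₂ ^ 2) + (y₁ + y₁ ^ 2) * (y₂ + y₂ ^ 2) +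
      E.d₁ * (x₁ + y₁ + x₂ + y₂) = W at *
  have h2 : (2 : F) = 0 := CharTwo.two_eq_zero
  field_simp
  linear_combination (E.d₁ * U * V + E.d₂ * (X * V + Y * U) + E.d₂ * E.d₁ * W) * i1 -
    Y * (Y + V) * i2 - E.d₁ * A * i3 + E.d₁ ^ 2 * i4 - E.d₂ * X * V * Y * U * h2

/-- The addition law. -/
instance [Module.Finite (ZMod 2) F] : Add E.Point where
  add P Q :=
    { x := E.num P.x P.y Q.x Q.y / E.den P.x Q.x Q.y
      y := E.num P.y P.x Q.y Q.x / E.den P.y Q.x Q.y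
      equation := E.equation_add P.equation Q.equation }

variable {E}

/-- `(X, Y, Z)` are projective coordinates of the point `P`: `x = X / Z` and `y = Y / Z`. -/
def Represents (X Y Z : F) (P : E.Point) : Prop := Z ≠ 0 ∧ X / Z = P.x ∧ Y / Z = P.y

end EdwardsCurve

/-- `C` implements point addition on the curve `E`: for all projective coordinates of two points
it maps `|X₁⟩|Y₁⟩|Z₁⟩|X₂⟩|Y₂⟩|Z₂⟩|0⟩|0⟩|0⟩` to `|X₁⟩|Y₁⟩|Z₁⟩|X₂⟩|Y₂⟩|Z₂⟩|X₃⟩|Y₃⟩|Z₃⟩`, where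
`(X₃, Y₃, Z₃)` are projective coordinates of the sum; the ancilla qubits start in `|0⟩` and are
returned to `|0⟩`. -/
def IsPointAdder {F : Type*} [Field F] [Algebra (ZMod 2) F] (pb : PowerBasis (ZMod 2) F)
    (E : EdwardsCurve F) {a : ℕ} (C : Circuit (Wire 9 pb.dim a)) : Prop :=
  haveI : Module.Finite (ZMod 2) F := pb.finite
  ∀ (P₁ P₂ : E.Point) (X₁ Y₁ Z₁ X₂ Y₂ Z₂ : F),
    EdwardsCurve.Represents X₁ Y₁ Z₁ P₁ → EdwardsCurve.Represents X₂ Y₂ Z₂ P₂ →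
    ∃ X₃ Y₃ Z₃ : F, EdwardsCurve.Represents X₃ Y₃ Z₃ (P₁ + P₂) ∧
      C.run (ket (encode pb a ![X₁, Y₁, Z₁, X₂, Y₂, Z₂, 0, 0, 0])) =
        ket (encode pb a ![X₁, Y₁, Z₁, X₂, Y₂, Z₂, X₃, Y₃, Z₃])

/-! Adding `y₁` to the first coordinate of the sum makes its numerator factor well: over the
denominator of `x₃`, `x₃ + y₁` has numerator `(x₁ + y₁)(d₁ + d₂(x₂ + y₂)) + x₂(d₁ + (x₁ + x₁²)(y₂ +
1))`. Exchanging `x` and `y` gives the numerator of `y₃ + x₁`, and the first summand, being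
symmetric, is shared. Let `N`, `N'`, `U`, `V` be the numerators and denominators after clearing by
`(Z₁ Z₂)²`. Then `(N V Z₁ + U V Y₁, N' U Z₁ + U V X₁, U V Z₁)` represents the sum, and the last
entry is nonzero because the denominators of the addition law never vanish.

These entries need 21 products, arranged in five layers, and four linear maps over the prime field:
three multiplications by a curve constant, and `z ↦ d₁ z²`, which is additive in characteristic 2.
The linear maps occur only in layers two and three. Every unit works on its own copies of its
operands and its own ancillae, so that a layer runs in parallel; the copying costs CNOT depth
`O(1)`.

Every operation adds a function of other registers to its target and hence is an involution.
Therefore the intermediate values are removed by the same operations in reverse order, and the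
multiplier never has to be inverted. Of the 21 products, 18 are intermediate and 3 go to the output,
which gives `18 + 3 + 18 = 39` multiplications in `4 + 1 + 4` layers, and `2 · 4 = 8` linear maps.

A linear map is split into the `n` cyclic diagonals of its matrix. Each diagonal is a set of CNOT
gates on disjoint wires, whence depth at most `n` and at most `n²` gates. All cost bounds are proved
for arbitrary weights, and depth, `T`-depth and gate counts are special cases. The semantic side
rests on `Circuit.run_relabel_ket`, `RegOp.run_compile` and `RegOp.foldl_exec_apply`. -/

namespace Gate

/-! ### Gates under relabelling of wires. -/

variable {ι κ : Type*}

/-- A gate on relabelled wires. -/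
def map (e : ι → κ) (he : Function.Injective e) : Gate ι → Gate κ
  | one u q => one u (e q)
  | cnot c t h => cnot (e c) (e t) (he.ne h)

@[simp]
theorem weight_map (e : ι → κ) (he : Function.Injective e) (w : OneQubit → ℕ) (wC : ℕ)
    (g : Gate ι) : (g.map e he).weight w wC = g.weight w wC := by
  cases g <;> rfl

theorem wires_map (e : ι → κ) (he : Function.Injective e) (g : Gate ι) :
    (g.map e he).wires = e '' g.wires := by
  cases g <;> simp [map, wires, Set.image_pair]

theorem share_map (e : ι → κ) (he : Function.Injective e) (g h : Gate ι) :
    Share (g.map e he) (h.map e he) ↔ Share g h := by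
  simp only [Share, wires_map, ← Set.image_inter he, Set.image_nonempty]

variable [DecidableEq ι] [DecidableEq κ]

theorem apply_zero (g : Gate ι) : g.apply (0 : QState ι) = 0 := by
  cases g <;> (funext b; simp [apply])

/-- Amplitudes are pulled back along a map of bit strings; as control and target differ, this map is
an involution, so basis states are pushed forward along the same map. -/
theorem apply_cnot_ket [Fintype ι] {c t : ι} (h : c ≠ t) (b : ι → ZMod 2) :
    (cnot c t h).apply (ket b) = ket (Function.update b t (b t + b c)) := by
  funext b'
  have key : Function.update b' t (b' t + b' c) = b ↔
      b' = Function.update b t (b t + b c) := by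
    constructor
    · rintro rfl
      funext x
      by_cases hx : x = t
      · subst hx
        simp [Function.update_of_ne h, add_assoc, CharTwo.add_self_eq_zero]
      · simp [Function.update_of_ne hx]
    · rintro rfl
      funext x
      by_cases hx : x = t
      · subst hx
        simp [Function.update_of_ne h, add_assoc, CharTwo.add_self_eq_zero]
      · simp [Function.update_of_ne hx]
  simp only [apply, ket, key]

/-- Wires outside the range of `e` are spectators: with their bits frozen to those of `b`, the
relabelled gate acts on the slice of `ψ` as the original gate does. -/
theorem apply_map_extend (e : ι → κ) (he : Function.Injective e) (g : Gate ι) (ψ : QState κ)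
    (b : κ → ZMod 2) (c : ι → ZMod 2) :
    (g.map e he).apply ψ (Function.extend e c b) =
      g.apply (fun c' => ψ (Function.extend e c' b)) c := by
  have hu (q : ι) (v : ZMod 2) : Function.update (Function.extend e c b) (e q) v =
      Function.extend e (Function.update c q v) b := by
    funext x
    by_cases hx : ∃ y, e y = x
    · obtain ⟨y, rfl⟩ := hx
      by_cases hy : y = q
      · subst hy; simp [he.extend_apply]
      · simp [he.extend_apply, he.ne hy, hy]
    · have : x ≠ e q := fun h => hx ⟨q, h.symm⟩
      simp [this, Function.extend_apply' _ _ _ hx]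
  cases g with
  | one u q => simp [map, apply, he.extend_apply, hu]
  | cnot s t h => simp [map, apply, he.extend_apply, hu]

end Gate

namespace Circuit

variable {ι κ : Type*}

/-- A circuit on relabelled wires. -/
def relabel (e : ι → κ) (he : Function.Injective e) (C : Circuit ι) : Circuit κ :=
  C.map (Gate.map e he)

/-! ### Action of relabelled circuits on states. -/

section Run

variable [DecidableEq ι] [DecidableEq κ]

theorem run_append (C D : Circuit ι) (ψ : QState ι) :
    run (C ++ D) ψ = run D (run C ψ) := List.foldl_append

theorem run_cons (g : Gate ι) (C : Circuit ι) (ψ : QState ι) :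
    run (g :: C) ψ = run C (g.apply ψ) := rfl

theorem run_zero (C : Circuit ι) : C.run (0 : QState ι) = 0 := by
  induction C with
  | nil => rfl
  | cons g C ih => rw [run_cons, Gate.apply_zero, ih]

theorem run_relabel_extend (e : ι → κ) (he : Function.Injective e) (C : Circuit ι)
    (ψ : QState κ) (b : κ → ZMod 2) (c : ι → ZMod 2) :
    (C.relabel e he).run ψ (Function.extend e c b) =
      C.run (fun c' => ψ (Function.extend e c' b)) c := by
  induction C generalizing ψ c with
  | nil => rfl
  | cons g C ih =>
    rw [run_cons]
    change (relabel e he C).run ((g.map e he).apply ψ) _ = _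
    rw [ih]
    congr 2
    funext c'
    exact Gate.apply_map_extend e he g ψ b c'

/-- A circuit on some of the wires leaves the other wires alone. -/
theorem run_relabel_ket [Fintype ι] [Fintype κ] (e : ι → κ) (he : Function.Injective e)
    (C : Circuit ι) (b : κ → ZMod 2) (c : ι → ZMod 2) (h : C.run (ket (b ∘ e)) = ket c) :
    (C.relabel e he).run (ket b) = ket (Function.extend e c b) := by
  funext b'
  have hb' : b' = Function.extend e (b' ∘ e) b' := by
    funext x
    by_cases hx : ∃ y, e y = x
    · obtain ⟨y, rfl⟩ := hx
      simp [he.extend_apply]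
    · simp [Function.extend_apply' _ _ _ hx]
  have hext (f g : ι → ZMod 2) (d : κ → ZMod 2) :
      Function.extend e f b' = Function.extend e g d ↔
        f = g ∧ ∀ x, (¬ ∃ y, e y = x) → b' x = d x := by
    constructor
    · intro H
      refine ⟨?_, fun x hx => ?_⟩
      · funext y
        simpa [he.extend_apply] using congrFun H (e y)
      · simpa [Function.extend_apply' _ _ _ hx] using congrFun H x
    · rintro ⟨rfl, H⟩
      funext x
      by_cases hx : ∃ y, e y = x
      · obtain ⟨y, rfl⟩ := hx
        simp [he.extend_apply]
      · simp [Function.extend_apply' _ _ _ hx, H x hx]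
  have hb : b = Function.extend e (b ∘ e) b := by
    funext x
    by_cases hx : ∃ y, e y = x
    · obtain ⟨y, rfl⟩ := hx
      simp [he.extend_apply]
    · simp [Function.extend_apply' _ _ _ hx]
  rw [hb', run_relabel_extend]
  -- If `b'` agrees with `b` off the range of `e`, the slice of `ket b` is a basis state; otherwise
  -- it is zero and remains zero.
  by_cases H : ∀ x, (¬ ∃ y, e y = x) → b' x = b x
  · have : (fun c' => ket b (Function.extend e c' b')) = ket (b ∘ e) := by
      funext c'
      have : Function.extend e c' b' = b ↔ c' = b ∘ e := by
        conv_lhs => rw [hb]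
        rw [hext]
        exact and_iff_left H
      simp only [ket, this]
    rw [this, h]
    have : Function.extend e (b' ∘ e) b' = Function.extend e c b ↔ b' ∘ e = c := by
      rw [hext]
      exact and_iff_left H
    simp only [ket, this]
  · have : (fun c' => ket b (Function.extend e c' b')) = 0 := by
      funext c'
      have : Function.extend e c' b' ≠ b := by
        intro h0
        rw [hb, hext] at h0
        exact H h0.2
      simp [ket, this]
    rw [this, run_zero]
    have : Function.extend e (b' ∘ e) b' ≠ Function.extend e c b := by
      intro h0
      rw [hext] at h0
      exact H h0.2
    simp [ket, this]

end Run

/-! ### Weights of circuits and of their paths. -/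

section Cost

variable (w : OneQubit → ℕ) (wC : ℕ)

@[simp]
theorem size_nil : size w wC ([] : Circuit ι) = 0 := rfl

@[simp]
theorem size_append (C D : Circuit ι) : size w wC (C ++ D) = C.size w wC + D.size w wC := by
  simp [size]

@[simp]
theorem size_relabel (e : ι → κ) (he : Function.Injective e) (C : Circuit ι) :
    (C.relabel e he).size w wC = C.size w wC := by
  simp [size, relabel, Function.comp_def]

theorem gateCount_eq_size (C : Circuit ι) : C.gateCount = C.size (fun _ => 1) 1 := by
  have : (Gate.weight (fun _ => 1) 1 : Gate ι → ℕ) = fun _ => 1 := by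
    funext g
    cases g <;> rfl
  simp [gateCount, size, this]

theorem sum_weight_le_span {C : Circuit ι} {p : List (Gate ι)} (hp : p.Sublist C)
    (hc : p.IsChain Gate.Share) : (p.map (Gate.weight w wC)).sum ≤ C.span w wC :=
  (span_le_iff w wC C _).1 le_rfl p hp hc

@[simp]
theorem span_nil : span w wC ([] : Circuit ι) = 0 := by
  rw [← Nat.le_zero, span_le_iff]
  intro p hp _
  simp [List.sublist_nil.1 hp]

theorem span_append_le (C D : Circuit ι) :
    span w wC (C ++ D) ≤ C.span w wC + D.span w wC := by
  rw [span_le_iff]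
  intro p hp hc
  obtain ⟨p₁, p₂, rfl, h₁, h₂⟩ := List.sublist_append_iff.1 hp
  rw [List.isChain_append] at hc
  rw [List.map_append, List.sum_append]
  exact add_le_add (sum_weight_le_span w wC h₁ hc.1) (sum_weight_le_span w wC h₂ hc.2.1)

theorem span_relabel_le (e : ι → κ) (he : Function.Injective e) (C : Circuit ι) :
    (C.relabel e he).span w wC ≤ C.span w wC := by
  rw [span_le_iff]
  intro p hp hc
  obtain ⟨q, hq, rfl⟩ := List.sublist_map_iff.1 hp
  rw [List.isChain_map] at hc
  simp only [Gate.share_map] at hc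
  simpa [Function.comp_def] using sum_weight_le_span w wC hq hc

/-- Circuits without common wires are executed in parallel. -/
theorem span_append_le_of_disjoint {C D : Circuit ι}
    (h : ∀ g ∈ C, ∀ g' ∈ D, Disjoint g.wires g'.wires) {m : ℕ} (hC : C.span w wC ≤ m)
    (hD : D.span w wC ≤ m) : span w wC (C ++ D) ≤ m := by
  rw [span_le_iff]
  intro p hp hc
  obtain ⟨p₁, p₂, rfl, h₁, h₂⟩ := List.sublist_append_iff.1 hp
  rw [List.isChain_append] at hc
  rcases List.eq_nil_or_concat p₁ with rfl | ⟨q₁, x, rfl⟩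
  · exact (sum_weight_le_span w wC h₂ hc.2.1).trans hD
  rcases p₂ with _ | ⟨y, q₂⟩
  · rw [List.append_nil]
    exact (sum_weight_le_span w wC h₁ hc.1).trans hC
  -- A path that meets both circuits would have two consecutive gates at the seam, and these share
  -- no wire.
  · exfalso
    have hs : Gate.Share x y := hc.2.2 x (by simp) y (by simp)
    have hd := h x (h₁.subset (by simp)) y (h₂.subset (by simp))
    exact Set.not_nonempty_iff_eq_empty.2 (Set.disjoint_iff_inter_eq_empty.1 hd) hs

theorem span_flatMap_le_of_pairwise {α : Type*} (f : α → Circuit ι) {m : ℕ} (l : List α)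
    (hl : l.Pairwise fun x y => ∀ g ∈ f x, ∀ g' ∈ f y, Disjoint g.wires g'.wires)
    (hm : ∀ x ∈ l, (f x).span w wC ≤ m) : span w wC (l.flatMap f) ≤ m := by
  induction l with
  | nil => simp
  | cons x l ih =>
    rw [List.pairwise_cons] at hl
    rw [List.flatMap_cons]
    refine span_append_le_of_disjoint w wC ?_ (hm x (by simp))
      (ih hl.2 fun y hy => hm y (by simp [hy]))
    intro g hg g' hg'
    obtain ⟨y, hy, hgy⟩ := List.mem_flatMap.1 hg'
    exact hl.1 y hy g hg g' hgy

theorem span_flatMap_le {α : Type*} (f : α → Circuit ι) {m : ℕ} (l : List α)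
    (hm : ∀ x ∈ l, (f x).span w wC ≤ m) : span w wC (l.flatMap f) ≤ l.length * m := by
  induction l with
  | nil => simp
  | cons x l ih =>
    rw [List.flatMap_cons, List.length_cons, Nat.succ_mul, add_comm]
    exact (span_append_le w wC _ _).trans
      (add_le_add (hm x (by simp)) (ih fun y hy => hm y (by simp [hy])))

theorem span_singleton_le (g : Gate ι) : span w wC [g] ≤ g.weight w wC := by
  rw [span_le_iff]
  intro p hp _
  rcases List.sublist_singleton.1 hp with rfl | rfl <;> simp

end Cost

end Circuit

/-! ## Straight-line programs on registers -/

/-- The wires of registers `Q` with `n` qubits each, and of `a` ancilla qubits for each of the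
multipliers `U`. -/
abbrev Bank (Q U : Type*) (n a : ℕ) := (Q × Fin n) ⊕ (U × Fin a)

/-- Operations on registers that hold field elements: `t += s`; `k += i * j` by the multiplier `u`;
`t += A s` for a linear map `A` with label `c`. -/
inductive RegOp (Q U κ : Type*) where
  | add (s t : Q)
  | mul (u : U) (i j k : Q)
  | lin (c : κ) (s t : Q)
  deriving DecidableEq

namespace RegOp

variable {Q U κ : Type*}

/-- The register that is changed. -/
def tgt : RegOp Q U κ → Q
  | add _ t => t
  | mul _ _ _ k => k
  | lin _ _ t => t

/-- The registers that are read. -/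
def srcs : RegOp Q U κ → List Q
  | add s _ => [s]
  | mul _ i j _ => [i, j]
  | lin _ s _ => [s]

/-- The registers and multipliers that are used. -/
def resources : RegOp Q U κ → List (Q ⊕ U)
  | add s t => [.inl s, .inl t]
  | mul u i j k => [.inl i, .inl j, .inl k, .inr u]
  | lin _ s t => [.inl s, .inl t]

/-- Two operations have no common resources. -/
def Independent (o o' : RegOp Q U κ) : Prop :=
  ∀ r ∈ o.resources, ∀ r' ∈ o'.resources, r ≠ r'

instance [DecidableEq Q] [DecidableEq U] : DecidableRel (Independent : RegOp Q U κ → _ → Prop) :=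
  fun o o' => inferInstanceAs (Decidable (∀ r ∈ o.resources, ∀ r' ∈ o'.resources, r ≠ r'))

/-- The registers of an operation are distinct. -/
def Valid : RegOp Q U κ → Prop
  | add s t => s ≠ t
  | mul _ i j k => i ≠ j ∧ i ≠ k ∧ j ≠ k
  | lin _ s t => s ≠ t

instance [DecidableEq Q] : DecidablePred (Valid : RegOp Q U κ → Prop)
  | add s t => inferInstanceAs (Decidable (s ≠ t))
  | mul _ i j k => inferInstanceAs (Decidable (i ≠ j ∧ i ≠ k ∧ j ≠ k))
  | lin _ s t => inferInstanceAs (Decidable (s ≠ t))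

/-- The number of multiplications, of linear maps and of additions. -/
def counts : RegOp Q U κ → ℕ × ℕ × ℕ
  | add _ _ => (0, 0, 1)
  | mul _ _ _ _ => (1, 0, 0)
  | lin _ _ _ => (0, 1, 0)

/-! ### Effect of programs on register contents. -/

section Semantics

variable {F : Type*} [Field F] [Algebra (ZMod 2) F] (A : κ → F →ₗ[ZMod 2] F)

/-- The field element that is added to the target. -/
def val (v : Q → F) : RegOp Q U κ → F
  | add s _ => v s
  | mul _ i j _ => v i * v j
  | lin c s _ => A c (v s)

/-- The effect on the contents of the registers. -/
def exec [DecidableEq Q] (v : Q → F) (op : RegOp Q U κ) : Q → F :=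
  Function.update v op.tgt (v op.tgt + op.val A v)

theorem val_congr {v v' : Q → F} {op : RegOp Q U κ} (h : ∀ q ∈ op.srcs, v q = v' q) :
    op.val A v = op.val A v' := by
  cases op <;> simp_all [srcs, val]

theorem tgt_notMem_srcs {op : RegOp Q U κ} (h : op.Valid) : op.tgt ∉ op.srcs := by
  cases op <;> simp_all [tgt, srcs, Valid, eq_comm]

variable [DecidableEq Q]

theorem val_update {v : Q → F} {op : RegOp Q U κ} {q : Q} (h : q ∉ op.srcs) (x : F) :
    op.val A (Function.update v q x) = op.val A v :=
  val_congr A fun p hp => Function.update_of_ne (fun e => h (by rwa [← e])) _ _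

/-- The target is not among the sources, so both runs add the same element, and the two copies
cancel in characteristic 2. -/
theorem exec_exec {op : RegOp Q U κ} (h : op.Valid) (v : Q → F) :
    op.exec A (op.exec A v) = v := by
  have : CharP F 2 := charP_of_injective_algebraMap (algebraMap (ZMod 2) F).injective 2
  have h' := val_update A (v := v) (tgt_notMem_srcs h) (v op.tgt + op.val A v)
  unfold exec
  rw [h', Function.update_self, Function.update_idem, add_assoc, CharTwo.add_self_eq_zero,
    add_zero, Function.update_eq_self]

/-- This is the uncomputation principle: since each operation is its own inverse, reversing the
order inverts the program. -/
theorem foldl_exec_reverse {l : List (RegOp Q U κ)} (h : ∀ op ∈ l, op.Valid) (v : Q → F) :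
    l.reverse.foldl (exec A) (l.foldl (exec A) v) = v := by
  induction l generalizing v with
  | nil => rfl
  | cons op l ih =>
    rw [List.reverse_cons, List.foldl_append, List.foldl_cons (b := v),
      ih (fun o ho => h o (by simp [ho]))]
    exact exec_exec A (h op (by simp)) v

/-- Operations that avoid the registers `T` commute with a change of these registers. -/
theorem foldl_exec_piecewise (T : Finset Q) {l : List (RegOp Q U κ)}
    (h : ∀ op ∈ l, op.tgt ∉ T ∧ ∀ q ∈ op.srcs, q ∉ T) (f v : Q → F) :
    l.foldl (exec A) (T.piecewise f v) = T.piecewise f (l.foldl (exec A) v) := by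
  induction l generalizing v with
  | nil => rfl
  | cons op l ih =>
    have h1 := h op (by simp)
    rw [List.foldl_cons, List.foldl_cons, ← ih (fun o ho => h o (by simp [ho]))]
    congr 1
    unfold exec
    rw [val_congr A (v' := v) fun q hq => T.piecewise_eq_of_notMem _ _ (h1.2 q hq),
      T.piecewise_eq_of_notMem _ _ h1.1, T.update_piecewise_of_notMem f v h1.1]

/-- No register is changed after it has been read. -/
def SingleAssignment : List (RegOp Q U κ) → Prop
  | [] => True
  | op :: l => (∀ q ∈ op.srcs, ∀ o ∈ op :: l, o.tgt ≠ q) ∧ SingleAssignment l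

instance decidableSingleAssignment :
    DecidablePred (SingleAssignment : List (RegOp Q U κ) → Prop)
  | [] => .isTrue trivial
  | op :: l =>
    have := decidableSingleAssignment l
    inferInstanceAs (Decidable ((∀ q ∈ op.srcs, ∀ o ∈ op :: l, o.tgt ≠ q) ∧ SingleAssignment l))

/-- The final contents of the registers satisfy the equations that the program reads as. -/
theorem foldl_exec_apply {l : List (RegOp Q U κ)} (h : SingleAssignment l) (v : Q → F) (t : Q) :
    l.foldl (exec A) v t =
      v t + ((l.filter (fun op => op.tgt = t)).map (val A (l.foldl (exec A) v))).sum := by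
  induction l generalizing v t with
  | nil => simp
  | cons op l ih =>
    rw [List.foldl_cons]
    -- Neither `op` nor a later operation writes to a source of `op`, so the value added now can be
    -- computed from the final contents.
    have hv : op.val A v = op.val A (l.foldl (exec A) (op.exec A v)) := by
      refine val_congr A fun q hq => ?_
      have h1 := h.1 q hq
      rw [ih h.2, List.filter_eq_nil_iff.2 (by simpa using fun o ho => h1 o (by simp [ho]))]
      have : q ≠ op.tgt := (h1 op (by simp)).symm
      simp [exec, this]
    conv_lhs => rw [ih h.2]
    by_cases ht : op.tgt = t
    · subst ht
      rw [List.filter_cons_of_pos (by simp), List.map_cons, List.sum_cons, ← hv, exec,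
        Function.update_self, add_assoc]
    · rw [List.filter_cons_of_neg (by simpa using ht), exec, Function.update_of_ne (Ne.symm ht)]

end Semantics

end RegOp

/-! ## Compilation of programs into circuits -/

/-! ### CNOT gates between two registers. -/

section Transfer

variable {Q U : Type*} {n a : ℕ}

/-- CNOT gates from the qubit `p.1` of register `s` to the qubit `p.2` of register `t` for all `p`
in a list. -/
def transfer {s t : Q} (h : s ≠ t) (l : List (Fin n × Fin n)) : Circuit (Bank Q U n a) :=
  l.map fun p => .cnot (.inl (s, p.1)) (.inl (t, p.2)) (by simp [h])

theorem size_transfer {s t : Q} (h : s ≠ t) (l : List (Fin n × Fin n)) (w : OneQubit → ℕ)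
    (wC : ℕ) : (transfer h l : Circuit (Bank Q U n a)).size w wC = l.length * wC := by
  simp [transfer, Circuit.size, Function.comp_def, Gate.weight]

theorem span_transfer_le {s t : Q} (h : s ≠ t) {l : List (Fin n × Fin n)}
    (hl : l.Pairwise fun p q => p.1 ≠ q.1 ∧ p.2 ≠ q.2) (w : OneQubit → ℕ) (wC : ℕ) :
    (transfer h l : Circuit (Bank Q U n a)).span w wC ≤ wC := by
  rw [transfer, List.map_eq_flatMap]
  refine Circuit.span_flatMap_le_of_pairwise w wC _ l (hl.imp ?_)
    fun p _ => Circuit.span_singleton_le w wC _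
  rintro p q ⟨h1, h2⟩ g hg g' hg'
  rw [List.mem_singleton] at hg hg'
  subst hg hg'
  simp [Gate.wires, h1.symm, h2.symm, h, h.symm]

/-- All controls lie in register `s ≠ t` and never change, so the contributions to a target bit
simply add up. -/
theorem run_transfer [DecidableEq Q] [DecidableEq U] [Fintype Q] [Fintype U] {s t : Q} (h : s ≠ t)
    (l : List (Fin n × Fin n)) (b b' : Bank Q U n a → ZMod 2)
    (ht : ∀ j, b' (.inl (t, j)) = b (.inl (t, j)) +
      (l.map fun p => if p.2 = j then b (.inl (s, p.1)) else 0).sum)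
    (hq : ∀ q j, q ≠ t → b' (.inl (q, j)) = b (.inl (q, j)))
    (hu : ∀ x, b' (.inr x) = b (.inr x)) :
    (transfer h l).run (ket b) = ket b' := by
  induction l generalizing b with
  | nil =>
    suffices b = b' by subst this; rfl
    funext x
    rcases x with ⟨q, j⟩ | x
    · by_cases hqt : q = t
      · subst hqt; simp [ht]
      · exact (hq q j hqt).symm
    · exact (hu x).symm
  | cons p l ih =>
    change (transfer h l).run (Gate.apply _ (ket b)) = _
    rw [Gate.apply_cnot_ket]
    apply ih
    · intro j
      rw [ht]
      have hs (i : Fin n) : (Sum.inl (s, i) : Bank Q U n a) ≠ .inl (t, p.2) := by simp [h]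
      simp only [List.map_cons, List.sum_cons, Function.update_of_ne (hs _)]
      by_cases hj : p.2 = j
      · subst hj
        simp [add_assoc]
      · simp [hj, Ne.symm hj]
    · intro q j hqt
      simp [hq q j hqt, hqt]
    · intro x
      simp [hu]

end Transfer

/-! ### Decomposition of a matrix into cyclic diagonals. -/

section LinearMaps

variable {n : ℕ}

/-- The pairs `(j, j)`. -/
def diagonalPairs (n : ℕ) : List (Fin n × Fin n) := (List.finRange n).map fun j => (j, j)

theorem sum_diagonalPairs (f : Fin n → ZMod 2) (i : Fin n) :
    ((diagonalPairs n).map fun p => if p.2 = i then f p.1 else 0).sum = f i := by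
  simp [diagonalPairs, Function.comp_def, ← List.ofFn_eq_map, List.sum_ofFn]

variable (B : Matrix (Fin n) (Fin n) (ZMod 2))

/-- The pairs `(j, j + k)` for which the entry of a matrix is one. -/
def shiftedPairs (k : Fin n) : List (Fin n × Fin n) :=
  ((List.finRange n).filter fun j => B (j + k) j = 1).map fun j => (j, j + k)

theorem length_shiftedPairs_le (k : Fin n) : (shiftedPairs B k).length ≤ n := by
  rw [shiftedPairs, List.length_map]
  exact (List.length_filter_le _ _).trans (by simp)

/-- On a cyclic diagonal, row and column determine each other; hence its CNOT gates are simultaneous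
and cost depth one. -/
theorem pairwise_shiftedPairs (k : Fin n) :
    (shiftedPairs B k).Pairwise fun p q => p.1 ≠ q.1 ∧ p.2 ≠ q.2 := by
  rw [shiftedPairs, List.pairwise_map]
  refine List.Pairwise.filter _ ((List.nodup_finRange n).imp ?_)
  intro i j h
  simp [h]

theorem sum_shiftedPairs [NeZero n] (f : Fin n → ZMod 2) (i : Fin n) :
    ((((List.finRange n).flatMap (shiftedPairs B)).map
      fun p => if p.2 = i then f p.1 else 0).sum) = B.mulVec f i := by
  have hB (x y : ZMod 2) : (if x = 1 then y else 0) = x * y := by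
    revert x y; decide
  have hk (k : Fin n) : ((shiftedPairs B k).map fun p => if p.2 = i then f p.1 else 0).sum =
      ∑ j, if j + k = i then B i j * f j else 0 := by
    have h1 (l : List (Fin n)) : ((l.filter fun j => B (j + k) j = 1).map
        fun j => if j + k = i then f j else 0).sum =
        (l.map fun j => if j + k = i then B i j * f j else 0).sum := by
      induction l with
      | nil => rfl
      | cons j l ih =>
        rw [List.map_cons, List.sum_cons, ← ih, ← hB, List.filter_cons]
        by_cases hj : j + k = i
        · subst hj
          by_cases h1 : B (j + k) j = 1 <;> simp [h1]
        · by_cases h1 : B (j + k) j = 1 <;> simp [h1, hj]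
    rw [shiftedPairs, List.map_map]
    exact (h1 _).trans (by rw [← List.ofFn_eq_map, List.sum_ofFn])
  have hsum (l : List (Fin n)) (g : Fin n → List (ZMod 2)) :
      (l.flatMap g).sum = (l.map fun k => (g k).sum).sum := by
    induction l with
    | nil => rfl
    | cons k l ih => simp [ih]
  rw [List.map_flatMap, hsum]
  simp only [hk]
  rw [← List.ofFn_eq_map, List.sum_ofFn, Finset.sum_comm]
  refine Finset.sum_congr rfl fun j _ => ?_
  -- The entry in row `i` and column `j` lies on exactly one cyclic diagonal, with shift `i - j`.
  rw [Finset.sum_eq_single (i - j)]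
  · simp
  · intro k _ hne
    rw [if_neg]
    rintro rfl
    simp at hne
  · simp

end LinearMaps

/-! ### Circuits of register operations and their cost. -/

section Compile

variable {Q U κ : Type*} {n a : ℕ}

/-- The wires of a multiplier with ancilla qubits `u` that acts on the registers `i`, `j`, `k`. -/
def multiplierWires (u : U) (i j k : Q) : Wire 3 n a → Bank Q U n a
  | .inl (r, x) => .inl (![i, j, k] r, x)
  | .inr x => .inr (u, x)

theorem multiplierWires_injective (u : U) {i j k : Q} (h : i ≠ j ∧ i ≠ k ∧ j ≠ k) :
    Function.Injective (multiplierWires u i j k : Wire 3 n a → Bank Q U n a) := by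
  obtain ⟨h1, h2, h3⟩ := h
  have hi : Function.Injective ![i, j, k] := by
    intro r r' hr
    fin_cases r <;> fin_cases r' <;> simp_all [eq_comm]
  rintro (⟨r, x⟩ | x) (⟨r', x'⟩ | x') hx
  · simp only [multiplierWires, Sum.inl.injEq, Prod.mk.injEq] at hx
    rw [hi hx.1, hx.2]
  · simp [multiplierWires] at hx
  · simp [multiplierWires] at hx
  · simp only [multiplierWires, Sum.inr.injEq, Prod.mk.injEq, true_and] at hx
    rw [hx]

namespace RegOp

variable [DecidableEq Q] (M : Circuit (Wire 3 n a)) (B : κ → Matrix (Fin n) (Fin n) (ZMod 2))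

/-- The circuit of an operation; `M` is used for multiplication, and linear maps have the matrices
`B`. -/
def circuit : RegOp Q U κ → Circuit (Bank Q U n a)
  | add s t => if h : s ≠ t then transfer h (diagonalPairs n) else []
  | mul u i j k =>
    if h : i ≠ j ∧ i ≠ k ∧ j ≠ k then M.relabel _ (multiplierWires_injective u h) else []
  | lin c s t =>
    if h : s ≠ t then transfer h ((List.finRange n).flatMap (shiftedPairs (B c))) else []

/-- The circuit of a program. -/
def compile (l : List (RegOp Q U κ)) : Circuit (Bank Q U n a) := l.flatMap (circuit M B)

@[simp]
theorem compile_nil : compile (Q := Q) (U := U) M B [] = [] := rfl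

theorem compile_cons (op : RegOp Q U κ) (l : List (RegOp Q U κ)) :
    compile M B (op :: l) = op.circuit M B ++ compile M B l := rfl

theorem compile_append (l l' : List (RegOp Q U κ)) :
    compile M B (l ++ l') = compile M B l ++ compile M B l' := List.flatMap_append

section Cost

variable (w : OneQubit → ℕ) (wC : ℕ)

/-- A bound on the weight of the paths in the circuit of an operation. -/
noncomputable def latency : RegOp Q U κ → ℕ
  | add _ _ => wC
  | mul _ _ _ _ => M.span w wC
  | lin _ _ _ => n * wC

theorem span_circuit_le (op : RegOp Q U κ) :
    (op.circuit M B).span w wC ≤ op.latency M w wC := by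
  cases op with
  | add s t =>
    rw [circuit]
    split_ifs with h
    · refine span_transfer_le h ?_ w wC
      rw [diagonalPairs, List.pairwise_map]
      exact (List.nodup_finRange n).imp fun h => ⟨h, h⟩
    · simp
  | mul u i j k =>
    rw [circuit]
    split_ifs
    · exact Circuit.span_relabel_le w wC _ _ M
    · simp
  | lin c s t =>
    rw [circuit]
    split_ifs with h
    · rw [transfer, List.map_flatMap]
      refine (Circuit.span_flatMap_le w wC _ (m := wC) _ fun k _ =>
        span_transfer_le h (pairwise_shiftedPairs (B c) k) w wC).trans ?_
      rw [List.length_finRange, latency]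
    · simp

/-- Forgetting the qubit index sends a wire to its register or multiplier; thus independent
operations touch disjoint wires. -/
theorem wires_subset_resources (op : RegOp Q U κ) {g : Gate (Bank Q U n a)}
    (hg : g ∈ op.circuit M B) {x : Bank Q U n a} (hx : x ∈ g.wires) :
    x.map Prod.fst Prod.fst ∈ op.resources := by
  have ht {s t : Q} (h : s ≠ t) (l : List (Fin n × Fin n))
      (hg : g ∈ (transfer h l : Circuit (Bank Q U n a))) :
      x.map Prod.fst Prod.fst ∈ ([.inl s, .inl t] : List (Q ⊕ U)) := by
    obtain ⟨p, -, rfl⟩ := List.mem_map.1 hg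
    rcases hx with rfl | rfl <;> simp
  cases op with
  | add s t =>
    rw [circuit] at hg
    split_ifs at hg with h
    · exact ht h _ hg
    · simp at hg
  | mul u i j k =>
    rw [circuit] at hg
    split_ifs at hg with h
    · obtain ⟨g', -, rfl⟩ := List.mem_map.1 hg
      rw [Gate.wires_map] at hx
      obtain ⟨⟨r, y⟩ | y, -, rfl⟩ := hx
      · fin_cases r <;> simp [multiplierWires, resources]
      · simp [multiplierWires, resources]
    · simp at hg
  | lin c s t =>
    rw [circuit] at hg
    split_ifs at hg with h
    · exact ht h _ hg
    · simp at hg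

/-- Operations without common resources are executed in parallel. -/
theorem span_compile_le_of_pairwise {l : List (RegOp Q U κ)}
    (hl : l.Pairwise Independent) {m : ℕ}
    (hm : ∀ op ∈ l, op.latency M w wC ≤ m) : (compile M B l).span w wC ≤ m := by
  refine Circuit.span_flatMap_le_of_pairwise w wC _ l (hl.imp ?_)
    fun op h => (span_circuit_le M B w wC op).trans (hm op h)
  intro o o' ho g hg g' hg'
  rw [Set.disjoint_left]
  intro x hx hx'
  exact ho _ (wires_subset_resources M B o hg hx) _ (wires_subset_resources M B o' hg' hx') rfl

theorem span_compile_le {l : List (RegOp Q U κ)} {m : ℕ}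
    (hm : ∀ op ∈ l, op.latency M w wC ≤ m) : (compile M B l).span w wC ≤ l.length * m :=
  Circuit.span_flatMap_le w wC _ l fun op h => (span_circuit_le M B w wC op).trans (hm op h)

/-- The number `k` of extra CNOT gates is chosen before the weights, and the formula is an equality;
weight 0 for CNOT then yields the exact `T`-count. -/
theorem size_circuit {op : RegOp Q U κ} (h : op.Valid) :
    ∃ k ≤ op.counts.2.1 * n ^ 2 + op.counts.2.2 * n, ∀ (w : OneQubit → ℕ) (wC : ℕ),
      (op.circuit M B).size w wC = op.counts.1 * M.size w wC + k * wC := by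
  cases op with
  | add s t =>
    replace h : s ≠ t := h
    refine ⟨n, by simp [counts], fun w wC => ?_⟩
    rw [circuit, dif_pos h, size_transfer]
    simp [counts, diagonalPairs]
  | mul u i j k =>
    replace h : i ≠ j ∧ i ≠ k ∧ j ≠ k := h
    refine ⟨0, by simp, fun w wC => ?_⟩
    rw [circuit, dif_pos h]
    simp [counts]
  | lin c s t =>
    replace h : s ≠ t := h
    refine ⟨((List.finRange n).flatMap (shiftedPairs (B c))).length, ?_, fun w wC => ?_⟩
    · rw [List.length_flatMap]
      refine (List.sum_le_card_nsmul _ n ?_).trans ?_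
      · simpa using fun k => length_shiftedPairs_le (B c) k
      · simp [counts, sq]
    · rw [circuit, dif_pos h, size_transfer]
      simp [counts]

theorem size_compile {l : List (RegOp Q U κ)} (h : ∀ op ∈ l, op.Valid) :
    ∃ k ≤ (l.map counts).sum.2.1 * n ^ 2 + (l.map counts).sum.2.2 * n,
      ∀ (w : OneQubit → ℕ) (wC : ℕ),
        (compile M B l).size w wC = (l.map counts).sum.1 * M.size w wC + k * wC := by
  induction l with
  | nil => exact ⟨0, by simp, fun w wC => by simp⟩
  | cons op l ih =>
    obtain ⟨k, hk, hs⟩ := ih fun o ho => h o (by simp [ho])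
    obtain ⟨k', hk', hs'⟩ := size_circuit M B (h op (by simp))
    refine ⟨k' + k, (add_le_add hk' hk).trans_eq ?_, fun w wC => ?_⟩
    · simp only [List.map_cons, List.sum_cons, Prod.snd_add, Prod.fst_add]
      ring
    · simp only [compile_cons, Circuit.size_append, hs, hs', List.map_cons, List.sum_cons,
        Prod.fst_add]
      ring

end Cost

end RegOp

end Compile

/-! ### Compiled circuits implement their programs. -/

section Correctness

variable {Q U κ : Type*} [DecidableEq Q] [DecidableEq U] [Fintype Q] [Fintype U]
  {F : Type*} [Field F] [Algebra (ZMod 2) F] (pb : PowerBasis (ZMod 2) F) {a : ℕ}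

/-- The bit string of registers with contents `v` and of ancilla bits equal to `0`. -/
noncomputable def bankEncode (U : Type*) (a : ℕ) (v : Q → F) : Bank Q U pb.dim a → ZMod 2
  | .inl (q, j) => pb.basis.repr (v q) j
  | .inr _ => 0

namespace RegOp

theorem run_circuit {M : Circuit (Wire 3 pb.dim a)} (hM : IsMultiplier pb M)
    (A : κ → F →ₗ[ZMod 2] F) {op : RegOp Q U κ} (h : op.Valid) (v : Q → F) :
    (op.circuit M fun c => LinearMap.toMatrix pb.basis pb.basis (A c)).run
      (ket (bankEncode pb U a v)) = ket (bankEncode pb U a (op.exec A v)) := by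
  have : NeZero pb.dim := ⟨pb.dim_pos.ne'⟩
  cases op with
  | add s t =>
    replace h : s ≠ t := h
    rw [circuit, dif_pos h]
    refine run_transfer h _ _ _ (fun j => ?_) (fun q j hq => ?_) fun x => rfl
    · rw [sum_diagonalPairs fun j => bankEncode pb U a v (.inl (s, j))]
      simp [bankEncode, exec, tgt, val]
    · simp [bankEncode, exec, tgt, hq]
  | mul u i j k =>
    replace h : i ≠ j ∧ i ≠ k ∧ j ≠ k := h
    rw [circuit, dif_pos h]
    have he := multiplierWires_injective (n := pb.dim) (a := a) u h
    rw [Circuit.run_relabel_ket _ he M _ (encode pb a ![v i, v j, v k + v i * v j])]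
    · congr 1
      funext x
      by_cases hx : ∃ y, multiplierWires u i j k y = x
      · obtain ⟨⟨r, y⟩ | y, rfl⟩ := hx
        · rw [he.extend_apply]
          obtain ⟨-, h2, h3⟩ := h
          fin_cases r <;> simp [multiplierWires, encode, bankEncode, exec, tgt, val, h2, h3]
        · rw [he.extend_apply]
          rfl
      · rw [Function.extend_apply' _ _ _ hx]
        rcases x with ⟨q, y⟩ | x
        -- Every qubit of register `k` is a wire of the multiplier, namely of its third register, so
        -- an untouched wire is not in `k`.
        · have : q ≠ k := by
            rintro rfl
            exact hx ⟨.inl (2, y), rfl⟩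
          simp [bankEncode, exec, tgt, this]
        · rfl
    · rw [← hM]
      congr 2
      funext x
      rcases x with ⟨r, y⟩ | y
      · fin_cases r <;> rfl
      · rfl
  | lin c s t =>
    replace h : s ≠ t := h
    rw [circuit, dif_pos h]
    refine run_transfer h _ _ _ (fun j => ?_) (fun q j hq => ?_) fun x => rfl
    · rw [sum_shiftedPairs _ fun j => bankEncode pb U a v (.inl (s, j))]
      simp [bankEncode, exec, tgt, val, LinearMap.toMatrix_mulVec_repr]
    · simp [bankEncode, exec, tgt, hq]

theorem run_compile {M : Circuit (Wire 3 pb.dim a)} (hM : IsMultiplier pb M)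
    (A : κ → F →ₗ[ZMod 2] F) {l : List (RegOp Q U κ)} (h : ∀ op ∈ l, op.Valid) (v : Q → F) :
    (compile M (fun c => LinearMap.toMatrix pb.basis pb.basis (A c)) l).run
      (ket (bankEncode pb U a v)) = ket (bankEncode pb U a (l.foldl (exec A) v)) := by
  induction l generalizing v with
  | nil => rfl
  | cons op l ih =>
    rw [compile_cons, Circuit.run_append, run_circuit pb hM A (h op (by simp)),
      ih fun o ho => h o (by simp [ho])]
    rfl

end RegOp

end Correctness

/-! ## Point addition -/

namespace EdwardsAdder

/-- Nine data registers, and three work registers for each of 25 arithmetic units. -/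
abbrev Reg := Fin 9 ⊕ Fin 25 × Fin 3

/-- The operations of the adder. -/
abbrev AdderOp := RegOp Reg (Fin 25) (Fin 3)

/-- A data register. -/
abbrev dat (i : Fin 9) : Reg := .inl i

/-- The first operand of a unit. -/
abbrev fst (u : Fin 25) : Reg := .inr (u, 0)

/-- The second operand of a unit. -/
abbrev snd (u : Fin 25) : Reg := .inr (u, 1)

/-- The result of a unit. -/
abbrev res (u : Fin 25) : Reg := .inr (u, 2)

/-- Copies a sum of registers to a register. -/
def load (t : Reg) (l : List Reg) : List AdderOp := l.map fun s => .add s t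

/-- The multiplication by a unit. -/
abbrev mulUnit (u : Fin 25) : AdderOp := .mul u (fst u) (snd u) (res u)

/-- The evaluation of a linear map by a unit. -/
abbrev linUnit (c : Fin 3) (u : Fin 25) : AdderOp := .lin c (fst u) (res u)

/-- The registers whose sums are the operands of the units `0, …, 20` (multiplications) and of the
units `21, …, 24` (linear maps). In the comments, `C` stands for `Z₁ Z₂`, and the points have the
sum `(Y₁ / Z₁ + N / U, X₁ / Z₁ + N' / V)`. -/
def operands : Fin 25 → List Reg × List Reg := ![
  -- `X₁ (X₁ + Z₁)`, `Y₁ (Y₁ + Z₁)`, `C`, `(X₂ + Y₂) Z₂`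
  ([dat 0], [dat 0, dat 2]), ([dat 1], [dat 1, dat 2]), ([dat 2], [dat 5]),
  ([dat 3, dat 4], [dat 5]),
  -- `U + d₁ C²`, `V + d₁ C²`, `(X₁ + Y₁) C`, `C Z₁`
  ([res 0], [res 3]), ([res 1], [res 3]), ([dat 0, dat 1], [res 2]), ([res 2], [dat 2]),
  -- `X₁ (X₁ + Z₁) (Y₂ + Z₂)`, `Y₁ (Y₁ + Z₁) (X₂ + Z₂)`
  ([res 0], [dat 4, dat 5]), ([res 1], [dat 3, dat 5]),
  -- `(d₁ Z₂ + d₂ (X₂ + Y₂)) (X₁ + Y₁) C`, `U V`, `V Z₁`, `U Z₁`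
  ([res 21, res 22], [res 6]), ([res 23, res 4], [res 23, res 5]),
  ([res 23, res 5], [dat 2]), ([res 23, res 4], [dat 2]),
  -- the remaining summands of `N` and `N'`
  ([dat 3], [res 24, res 8]), ([dat 4], [res 24, res 9]),
  -- `U V Y₁`, `U V X₁`
  ([res 11], [dat 1]), ([res 11], [dat 0]),
  -- `N V Z₁`, `N' U Z₁`, `U V Z₁`
  ([res 10, res 14], [res 12]), ([res 10, res 15], [res 13]), ([res 11], [dat 2]),
  -- `d₁ Z₂`, `d₂ (X₂ + Y₂)`, `d₁ C²`, `d₁ C Z₁`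
  ([dat 5], []), ([dat 3, dat 4], []), ([res 2], []), ([res 7], [])]

/-- Copies the operands of some units. -/
def loadUnits (l : List (Fin 25)) : List AdderOp :=
  l.flatMap fun u => load (fst u) (operands u).1 ++ load (snd u) (operands u).2

/-- The first layer of arithmetic operations. -/
def layer₁ : List AdderOp := [0, 1, 2, 3].map mulUnit

/-- The second layer of arithmetic operations. -/
def layer₂ : List AdderOp :=
  [4, 5, 6, 7, 8, 9].map mulUnit ++ [linUnit 0 21, linUnit 1 22, linUnit 2 23]

/-- The third layer of arithmetic operations. -/
def layer₃ : List AdderOp := [10, 11, 12, 13].map mulUnit ++ [linUnit 0 24]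

/-- The fourth layer of arithmetic operations. -/
def layer₄ : List AdderOp := [14, 15, 16, 17].map mulUnit

/-- The layer of multiplications that write to the output registers. -/
def outLayer : List AdderOp :=
  [.mul 18 (fst 18) (snd 18) (dat 6), .mul 19 (fst 19) (snd 19) (dat 7),
    .mul 20 (fst 20) (snd 20) (dat 8)]

/-- The remaining summands of the output. -/
def outAdd : List AdderOp := [.add (res 16) (dat 6), .add (res 17) (dat 7)]

/-- The part of the adder that computes intermediate results. -/
def forward : List AdderOp :=
  loadUnits [0, 1, 2, 3] ++ (layer₁ ++ (loadUnits [4, 5, 6, 7, 8, 9, 21, 22, 23] ++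
    (layer₂ ++ (loadUnits [10, 11, 12, 13, 24] ++ (layer₃ ++ (loadUnits [14, 15, 16, 17] ++
      (layer₄ ++ loadUnits [18, 19, 20])))))))

/-- The part of the adder that computes the output. -/
def output : List AdderOp := outLayer ++ outAdd

/-- The program for point addition. -/
def program : List AdderOp := forward ++ (output ++ forward.reverse)

/-- The output registers. -/
def outputs : Finset Reg := {dat 6, dat 7, dat 8}

/-! ### Finite checks of the explicit program. -/

section Structure

set_option maxRecDepth 100000

theorem valid_forward : ∀ op ∈ forward, op.Valid := by decide

theorem valid_program : ∀ op ∈ program, op.Valid := by decide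

theorem singleAssignment_forward : RegOp.SingleAssignment forward := by decide

theorem singleAssignment_output : RegOp.SingleAssignment output := by decide

theorem forward_avoids_outputs :
    ∀ op ∈ forward, op.tgt ∉ outputs ∧ ∀ q ∈ op.srcs, q ∉ outputs := by decide

theorem output_tgt : ∀ op ∈ output, op.tgt ∈ outputs := by decide

/-- The three entries arise as `18 + 3 + 18`, `4 + 4` and `62 + 2 + 62`. -/
theorem counts_program : (program.map RegOp.counts).sum = (39, 8, 126) := by decide

theorem filter_fst (u : Fin 25) :
    forward.filter (fun op => op.tgt = fst u) = load (fst u) (operands u).1 := by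
  revert u; decide

theorem filter_snd (u : Fin 25) :
    forward.filter (fun op => op.tgt = snd u) = load (snd u) (operands u).2 := by
  revert u; decide

/-- Units 18, 19 and 20 are excluded, as their products go directly to the output registers. -/
theorem filter_mul (u : Fin 25) (h : u < 18) :
    forward.filter (fun op => op.tgt = res u) = [mulUnit u] := by
  revert u; decide

theorem filter_lin : ∀ p ∈ [((0 : Fin 3), (21 : Fin 25)), (1, 22), (2, 23), (0, 24)],
    forward.filter (fun op => op.tgt = res p.2) = [linUnit p.1 p.2] := by
  decide

theorem filter_dat (i : Fin 9) : forward.filter (fun op => op.tgt = dat i) = [] := by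
  revert i; decide

theorem mem_outputs_inl (i : Fin 9) : (.inl i : Reg) ∈ outputs ↔ 6 ≤ i := by
  revert i; decide

theorem inr_notMem_outputs (r : Fin 25 × Fin 3) : (.inr r : Reg) ∉ outputs := by
  simp [outputs]

theorem piecewise_outputs {F : Type*} [Zero F] (f : Reg → F) (x₀ x₁ x₂ x₃ x₄ x₅ x₆ x₇ x₈ : F) :
    outputs.piecewise f (Sum.elim ![x₀, x₁, x₂, x₃, x₄, x₅, x₆, x₇, x₈] 0) =
      Sum.elim ![x₀, x₁, x₂, x₃, x₄, x₅, f (dat 6), f (dat 7), f (dat 8)] 0 := by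
  have key : (fun i => if 6 ≤ i then f (dat i) else ![x₀, x₁, x₂, x₃, x₄, x₅, x₆, x₇, x₈] i) =
      ![x₀, x₁, x₂, x₃, x₄, x₅, f (dat 6), f (dat 7), f (dat 8)] := by
    funext i
    fin_cases i <;> rfl
  rw [← key]
  funext r
  rcases r with i | r
  · simp only [Finset.piecewise, mem_outputs_inl, Sum.elim_inl]
  · exact outputs.piecewise_eq_of_notMem _ _ (inr_notMem_outputs r)

end Structure

/-! ### Depth of the adder. -/

section Span

variable {n a : ℕ} (M : Circuit (Wire 3 n a)) (B : Fin 3 → Matrix (Fin n) (Fin n) (ZMod 2))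
  (w : OneQubit → ℕ) (wC : ℕ)

/-- Copies are bounded as if they were sequential: each is one layer of CNOT gates, and their number
is an absolute constant. -/
theorem span_load_le {l : List AdderOp} {m : ℕ}
    (h : (∀ op ∈ l, op.counts = (0, 0, 1)) ∧ l.length ≤ m) :
    (RegOp.compile M B l).span w wC ≤ m * wC := by
  refine (RegOp.span_compile_le M B w wC (m := wC) fun op hop => ?_).trans
    (Nat.mul_le_mul_right _ h.2)
  have := h.1 op hop
  cases op <;> simp_all [RegOp.counts, RegOp.latency]

theorem span_mul_layer_le {l : List AdderOp} (h : ∀ op ∈ l, op.counts = (1, 0, 0))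
    (hl : l.Pairwise RegOp.Independent) :
    (RegOp.compile M B l).span w wC ≤ M.span w wC := by
  refine RegOp.span_compile_le_of_pairwise M B w wC hl fun op hop => ?_
  have := h op hop
  cases op <;> simp_all [RegOp.counts, RegOp.latency]

theorem span_mixed_layer_le {l : List AdderOp} (h : ∀ op ∈ l, op.counts.2.2 = 0)
    (hl : l.Pairwise RegOp.Independent) :
    (RegOp.compile M B l).span w wC ≤ max (M.span w wC) (n * wC) := by
  refine RegOp.span_compile_le_of_pairwise M B w wC hl fun op hop => ?_
  have := h op hop
  cases op <;> simp_all [RegOp.counts, RegOp.latency]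

set_option maxRecDepth 100000 in
theorem span_program_le :
    (RegOp.compile M B program).span w wC ≤
      5 * M.span w wC + 4 * max (M.span w wC) (n * wC) + 126 * wC := by
  have key (p q : List AdderOp) {x y : ℕ} (hx : (RegOp.compile M B p).span w wC ≤ x)
      (hy : (RegOp.compile M B q).span w wC ≤ y) :
      (RegOp.compile M B (p ++ q)).span w wC ≤ x + y := by
    rw [RegOp.compile_append]
    exact (Circuit.span_append_le w wC _ _).trans (add_le_add hx hy)
  -- The values of `m` are the numbers of copies: `11 + 19 + 14 + 10 + 8 = 62` in each direction,
  -- and 2 more in `outAdd`.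
  have h₁ := span_load_le M B w wC (l := loadUnits [0, 1, 2, 3]) (m := 11) (by decide)
  have h₁' := span_load_le M B w wC (l := (loadUnits [0, 1, 2, 3]).reverse) (m := 11) (by decide)
  have h₂ := span_load_le M B w wC (l := loadUnits [4, 5, 6, 7, 8, 9, 21, 22, 23]) (m := 19)
    (by decide)
  have h₂' := span_load_le M B w wC (l := (loadUnits [4, 5, 6, 7, 8, 9, 21, 22, 23]).reverse)
    (m := 19) (by decide)
  have h₃ := span_load_le M B w wC (l := loadUnits [10, 11, 12, 13, 24]) (m := 14) (by decide)
  have h₃' := span_load_le M B w wC (l := (loadUnits [10, 11, 12, 13, 24]).reverse) (m := 14)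
    (by decide)
  have h₄ := span_load_le M B w wC (l := loadUnits [14, 15, 16, 17]) (m := 10) (by decide)
  have h₄' := span_load_le M B w wC (l := (loadUnits [14, 15, 16, 17]).reverse) (m := 10)
    (by decide)
  have h₅ := span_load_le M B w wC (l := loadUnits [18, 19, 20]) (m := 8) (by decide)
  have h₅' := span_load_le M B w wC (l := (loadUnits [18, 19, 20]).reverse) (m := 8) (by decide)
  have h₆ := span_load_le M B w wC (l := outAdd) (m := 2) (by decide)
  have l₁ := span_mul_layer_le M B w wC (l := layer₁) (by decide) (by decide)
  have l₁' := span_mul_layer_le M B w wC (l := layer₁.reverse) (by decide) (by decide)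
  have l₂ := span_mixed_layer_le M B w wC (l := layer₂) (by decide) (by decide)
  have l₂' := span_mixed_layer_le M B w wC (l := layer₂.reverse) (by decide) (by decide)
  have l₃ := span_mixed_layer_le M B w wC (l := layer₃) (by decide) (by decide)
  have l₃' := span_mixed_layer_le M B w wC (l := layer₃.reverse) (by decide) (by decide)
  have l₄ := span_mul_layer_le M B w wC (l := layer₄) (by decide) (by decide)
  have l₄' := span_mul_layer_le M B w wC (l := layer₄.reverse) (by decide) (by decide)
  have l₅ := span_mul_layer_le M B w wC (l := outLayer) (by decide) (by decide)
  have hf := key _ _ h₁ <| key _ _ l₁ <| key _ _ h₂ <| key _ _ l₂ <| key _ _ h₃ <| key _ _ l₃ <|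
    key _ _ h₄ <| key _ _ l₄ h₅
  have hr := key _ _ h₅' <| key _ _ l₄' <| key _ _ h₄' <| key _ _ l₃' <| key _ _ h₃' <|
    key _ _ l₂' <| key _ _ h₂' <| key _ _ l₁' h₁'
  have h := key _ _ hf <| key _ _ (key _ _ l₅ h₆) hr
  simp only [program, output, forward, List.reverse_append, List.append_assoc] at h ⊢
  refine h.trans (le_of_eq ?_)
  ring

end Span

/-! ### Equations satisfied by the register contents. -/

section Semantics

variable {F : Type*} [Field F] [Algebra (ZMod 2) F] (A : Fin 3 → F →ₗ[ZMod 2] F) (v : Reg → F)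

theorem foldl_load (t : Reg) (l : List Reg) (f : Reg → F) :
    ((load t l).map (RegOp.val A f)).sum = (l.map f).sum := by
  simp [load, Function.comp_def, RegOp.val]

theorem forward_dat (i : Fin 9) : forward.foldl (RegOp.exec A) v (dat i) = v (dat i) := by
  rw [RegOp.foldl_exec_apply A singleAssignment_forward, filter_dat]
  simp

theorem forward_fst (u : Fin 25) (h : v (fst u) = 0) : forward.foldl (RegOp.exec A) v (fst u) =
    ((operands u).1.map (forward.foldl (RegOp.exec A) v)).sum := by
  rw [RegOp.foldl_exec_apply A singleAssignment_forward, filter_fst, h, zero_add, foldl_load]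

theorem forward_snd (u : Fin 25) (h : v (snd u) = 0) : forward.foldl (RegOp.exec A) v (snd u) =
    ((operands u).2.map (forward.foldl (RegOp.exec A) v)).sum := by
  rw [RegOp.foldl_exec_apply A singleAssignment_forward, filter_snd, h, zero_add, foldl_load]

theorem forward_mul (hv : ∀ r, v (.inr r) = 0) (u : Fin 25) (h : u < 18) :
    forward.foldl (RegOp.exec A) v (res u) =
      ((operands u).1.map (forward.foldl (RegOp.exec A) v)).sum *
        ((operands u).2.map (forward.foldl (RegOp.exec A) v)).sum := by
  rw [RegOp.foldl_exec_apply A singleAssignment_forward, filter_mul u h, hv, zero_add,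
    List.map_singleton, List.sum_singleton, RegOp.val, forward_fst A v u (hv _),
    forward_snd A v u (hv _)]

theorem forward_lin (hv : ∀ r, v (.inr r) = 0) (c : Fin 3) (u : Fin 25)
    (h : (c, u) ∈ [((0 : Fin 3), (21 : Fin 25)), (1, 22), (2, 23), (0, 24)]) :
    forward.foldl (RegOp.exec A) v (res u) =
      A c ((operands u).1.map (forward.foldl (RegOp.exec A) v)).sum := by
  rw [RegOp.foldl_exec_apply A singleAssignment_forward, filter_lin (c, u) h, hv, zero_add,
    List.map_singleton, List.sum_singleton, RegOp.val, forward_fst A v u (hv _)]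

theorem foldl_program : program.foldl (RegOp.exec A) v =
    outputs.piecewise (output.foldl (RegOp.exec A) (forward.foldl (RegOp.exec A) v)) v := by
  set v₁ := forward.foldl (RegOp.exec A) v with h₁
  set v₂ := output.foldl (RegOp.exec A) v₁ with h₂
  -- The output stage changes output registers only. The forward part avoids these, so its reversal
  -- commutes with that change and restores all other registers.
  have h : v₂ = outputs.piecewise v₂ v₁ := by
    funext t
    by_cases ht : t ∈ outputs
    · rw [outputs.piecewise_eq_of_mem _ _ ht]
    · rw [outputs.piecewise_eq_of_notMem _ _ ht, h₂,
        RegOp.foldl_exec_apply A singleAssignment_output, List.filter_eq_nil_iff.2]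
      · simp
      · intro op hop
        rw [decide_eq_true_iff]
        rintro rfl
        exact ht (output_tgt op hop)
  rw [program, List.foldl_append, List.foldl_append, ← h₁, ← h₂]
  conv_lhs => rw [h]
  rw [RegOp.foldl_exec_piecewise A outputs, h₁, RegOp.foldl_exec_reverse A valid_forward]
  simpa using forward_avoids_outputs

set_option maxRecDepth 100000 in
theorem foldl_output :
    output.foldl (RegOp.exec A) v (dat 6) = v (dat 6) + (v (fst 18) * v (snd 18) + v (res 16)) ∧
    output.foldl (RegOp.exec A) v (dat 7) = v (dat 7) + (v (fst 19) * v (snd 19) + v (res 17)) ∧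
    output.foldl (RegOp.exec A) v (dat 8) = v (dat 8) + v (fst 20) * v (snd 20) := by
  simp [output, outLayer, outAdd, RegOp.exec, RegOp.tgt, RegOp.val, add_assoc]

end Semantics

/-! ### The projective addition formulas. -/

section Curve

variable {F : Type*} [Field F] [Algebra (ZMod 2) F] (E : EdwardsCurve F)

/-- `z ↦ d₁ z ^ 2` as a linear map. -/
def mulSq (d : F) : F →ₗ[ZMod 2] F where
  toFun z := d * z ^ 2
  map_add' x y := by
    have : CharP F 2 := charP_of_injective_algebraMap (algebraMap (ZMod 2) F).injective 2
    rw [CharTwo.add_sq, mul_add]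
  map_smul' c x := by
    have hc : c ^ 2 = c := by revert c; decide
    rw [smul_pow, hc, mul_smul_comm, RingHom.id_apply]

/-- The linear maps that the adder evaluates. -/
def linearMaps : Fin 3 → F →ₗ[ZMod 2] F :=
  ![LinearMap.mulLeft (ZMod 2) E.d₁, LinearMap.mulLeft (ZMod 2) E.d₂, mulSq E.d₁]

/-- The denominator of the first coordinate in projective coordinates. -/
def projDen (X₁ Z₁ X₂ Y₂ Z₂ : F) : F :=
  E.d₁ * (Z₁ * Z₂) ^ 2 + X₁ * (X₁ + Z₁) * ((X₂ + Y₂) * Z₂)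

/-- The numerator of the difference of the first coordinate and `Y₁ / Z₁` in projective
coordinates. -/
def projNum (X₁ Y₁ Z₁ X₂ Y₂ Z₂ : F) : F :=
  (E.d₁ * Z₂ + E.d₂ * (X₂ + Y₂)) * ((X₁ + Y₁) * (Z₁ * Z₂)) +
    X₂ * (E.d₁ * (Z₁ * Z₂ * Z₁) + X₁ * (X₁ + Z₁) * (Y₂ + Z₂))

theorem projDen_mul (x₁ Z₁ x₂ y₂ Z₂ : F) :
    projDen E (x₁ * Z₁) Z₁ (x₂ * Z₂) (y₂ * Z₂) Z₂ = E.den x₁ x₂ y₂ * (Z₁ * Z₂) ^ 2 := by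
  unfold projDen EdwardsCurve.den
  ring

/-- Adding `y₁` times the denominator cancels the terms with `y₁ y₂` and `x₂ y₁` in the numerator,
which leaves `x₂ (y₂ + 1)` as the cofactor of `x₁ + x₁²`. -/
theorem projNum_mul (x₁ y₁ Z₁ x₂ y₂ Z₂ : F) :
    projNum E (x₁ * Z₁) (y₁ * Z₁) Z₁ (x₂ * Z₂) (y₂ * Z₂) Z₂ =
      (E.num x₁ y₁ x₂ y₂ + y₁ * E.den x₁ x₂ y₂) * (Z₁ * Z₂) ^ 2 := by
  have : CharP F 2 := charP_of_injective_algebraMap (algebraMap (ZMod 2) F).injective 2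
  have h2 : (2 : F) = 0 := CharTwo.two_eq_zero
  unfold projNum EdwardsCurve.num EdwardsCurve.den
  grind

/-- The values that the equations of the forward part determine. -/
theorem output_of_equations {X₁ Y₁ Z₁ X₂ Y₂ Z₂ : F} {f : Reg → F}
    (hd : ∀ i, f (dat i) = ![X₁, Y₁, Z₁, X₂, Y₂, Z₂, 0, 0, 0] i)
    (hf : ∀ u, f (fst u) = ((operands u).1.map f).sum)
    (hs : ∀ u, f (snd u) = ((operands u).2.map f).sum)
    (hm : ∀ u < 18, f (res u) = ((operands u).1.map f).sum * ((operands u).2.map f).sum)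
    (hl : ∀ c u, (c, u) ∈ [((0 : Fin 3), (21 : Fin 25)), (1, 22), (2, 23), (0, 24)] →
      f (res u) = linearMaps E c ((operands u).1.map f).sum) :
    f (fst 18) * f (snd 18) + f (res 16) =
        projNum E X₁ Y₁ Z₁ X₂ Y₂ Z₂ * (projDen E Y₁ Z₁ X₂ Y₂ Z₂ * Z₁) +
          projDen E X₁ Z₁ X₂ Y₂ Z₂ * projDen E Y₁ Z₁ X₂ Y₂ Z₂ * Y₁ ∧
      f (fst 19) * f (snd 19) + f (res 17) =
        projNum E Y₁ X₁ Z₁ Y₂ X₂ Z₂ * (projDen E X₁ Z₁ X₂ Y₂ Z₂ * Z₁) +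
          projDen E X₁ Z₁ X₂ Y₂ Z₂ * projDen E Y₁ Z₁ X₂ Y₂ Z₂ * X₁ ∧
      f (fst 20) * f (snd 20) =
        projDen E X₁ Z₁ X₂ Y₂ Z₂ * projDen E Y₁ Z₁ X₂ Y₂ Z₂ * Z₁ := by
  have A0 (z : F) : linearMaps E 0 z = E.d₁ * z := rfl
  have A1 (z : F) : linearMaps E 1 z = E.d₂ * z := rfl
  have A2 (z : F) : linearMaps E 2 z = E.d₁ * z ^ 2 := rfl
  have d0 : f (dat 0) = X₁ := hd 0
  have d1 : f (dat 1) = Y₁ := hd 1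
  have d2 : f (dat 2) = Z₁ := hd 2
  have d3 : f (dat 3) = X₂ := hd 3
  have d4 : f (dat 4) = Y₂ := hd 4
  have d5 : f (dat 5) = Z₂ := hd 5
  have m0 := hm 0 (by decide)
  have m1 := hm 1 (by decide)
  have m2 := hm 2 (by decide)
  have m3 := hm 3 (by decide)
  have m4 := hm 4 (by decide)
  have m5 := hm 5 (by decide)
  have m6 := hm 6 (by decide)
  have m7 := hm 7 (by decide)
  have m8 := hm 8 (by decide)
  have m9 := hm 9 (by decide)
  have m10 := hm 10 (by decide)
  have m11 := hm 11 (by decide)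
  have m12 := hm 12 (by decide)
  have m13 := hm 13 (by decide)
  have m14 := hm 14 (by decide)
  have m15 := hm 15 (by decide)
  have m16 := hm 16 (by decide)
  have m17 := hm 17 (by decide)
  have l21 := hl 0 21 (by decide)
  have l22 := hl 1 22 (by decide)
  have l23 := hl 2 23 (by decide)
  have l24 := hl 0 24 (by decide)
  have f18 := hf 18
  have f19 := hf 19
  have f20 := hf 20
  have s18 := hs 18
  have s19 := hs 19
  have s20 := hs 20
  simp only [operands, Matrix.cons_val, List.map_cons, List.map_nil, List.sum_cons, List.sum_nil,
    add_zero, A0, A1, A2, d0, d1, d2, d3, d4, d5]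
    at m0 m1 m2 m3 m4 m5 m6 m7 m8 m9 m10 m11 m12 m13 m14 m15 m16 m17 l21 l22 l23 l24 f18 f19 f20
      s18 s19 s20
  have hU : f (res 23) + f (res 4) = projDen E X₁ Z₁ X₂ Y₂ Z₂ := by
    rw [l23, m4, m2, m0, m3, projDen]
  have hV : f (res 23) + f (res 5) = projDen E Y₁ Z₁ X₂ Y₂ Z₂ := by
    rw [l23, m5, m2, m1, m3, projDen]
  have hN : f (res 10) + f (res 14) = projNum E X₁ Y₁ Z₁ X₂ Y₂ Z₂ := by
    rw [m10, m14, l21, l22, l24, m6, m7, m8, m0, m2, projNum]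
  -- The product in `res 10` is reused: it is symmetric under exchange of the coordinates, up to the
  -- commutations at the end.
  have hN' : f (res 10) + f (res 15) = projNum E Y₁ X₁ Z₁ Y₂ X₂ Z₂ := by
    rw [m10, m15, l21, l22, l24, m6, m7, m9, m1, m2, projNum, add_comm X₂, add_comm X₁]
  refine ⟨?_, ?_, ?_⟩
  · rw [f18, s18, m12, m16, m11, hU, hV, hN]
  · rw [f19, s19, m13, m17, m11, hU, hV, hN']
  · rw [f20, s20, m11, hU, hV]

theorem foldl_program_dat (X₁ Y₁ Z₁ X₂ Y₂ Z₂ : F) :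
    program.foldl (RegOp.exec (linearMaps E)) (Sum.elim ![X₁, Y₁, Z₁, X₂, Y₂, Z₂, 0, 0, 0] 0) =
      Sum.elim ![X₁, Y₁, Z₁, X₂, Y₂, Z₂,
        projNum E X₁ Y₁ Z₁ X₂ Y₂ Z₂ * (projDen E Y₁ Z₁ X₂ Y₂ Z₂ * Z₁) +
          projDen E X₁ Z₁ X₂ Y₂ Z₂ * projDen E Y₁ Z₁ X₂ Y₂ Z₂ * Y₁,
        projNum E Y₁ X₁ Z₁ Y₂ X₂ Z₂ * (projDen E X₁ Z₁ X₂ Y₂ Z₂ * Z₁) +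
          projDen E X₁ Z₁ X₂ Y₂ Z₂ * projDen E Y₁ Z₁ X₂ Y₂ Z₂ * X₁,
        projDen E X₁ Z₁ X₂ Y₂ Z₂ * projDen E Y₁ Z₁ X₂ Y₂ Z₂ * Z₁] 0 := by
  have hw (r) : (Sum.elim ![X₁, Y₁, Z₁, X₂, Y₂, Z₂, 0, 0, 0] 0 : Reg → F) (.inr r) = 0 := rfl
  obtain ⟨h6, h7, h8⟩ := output_of_equations E (forward_dat (linearMaps E) _)
    (fun u => forward_fst (linearMaps E) _ u (hw _)) (fun u => forward_snd (linearMaps E) _ u (hw _))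
    (forward_mul (linearMaps E) _ hw) (forward_lin (linearMaps E) _ hw)
  obtain ⟨o6, o7, o8⟩ := foldl_output (linearMaps E) (forward.foldl (RegOp.exec (linearMaps E))
    (Sum.elim ![X₁, Y₁, Z₁, X₂, Y₂, Z₂, 0, 0, 0] 0))
  rw [h6, forward_dat, Sum.elim_inl] at o6
  rw [h7, forward_dat, Sum.elim_inl] at o7
  rw [h8, forward_dat, Sum.elim_inl] at o8
  rw [foldl_program, piecewise_outputs, o6, o7, o8]
  simp

/-- Dividing by `U V Z₁` leaves `N / U + y₁`, and `N / U` is already the coordinate of the sum plus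
`y₁`; the two copies of `y₁` cancel. The second coordinate is analogous. -/
theorem represents_add [Module.Finite (ZMod 2) F] {P₁ P₂ : E.Point} {X₁ Y₁ Z₁ X₂ Y₂ Z₂ : F}
    (h₁ : EdwardsCurve.Represents X₁ Y₁ Z₁ P₁) (h₂ : EdwardsCurve.Represents X₂ Y₂ Z₂ P₂) :
    EdwardsCurve.Represents
      (projNum E X₁ Y₁ Z₁ X₂ Y₂ Z₂ * (projDen E Y₁ Z₁ X₂ Y₂ Z₂ * Z₁) +
        projDen E X₁ Z₁ X₂ Y₂ Z₂ * projDen E Y₁ Z₁ X₂ Y₂ Z₂ * Y₁)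
      (projNum E Y₁ X₁ Z₁ Y₂ X₂ Z₂ * (projDen E X₁ Z₁ X₂ Y₂ Z₂ * Z₁) +
        projDen E X₁ Z₁ X₂ Y₂ Z₂ * projDen E Y₁ Z₁ X₂ Y₂ Z₂ * X₁)
      (projDen E X₁ Z₁ X₂ Y₂ Z₂ * projDen E Y₁ Z₁ X₂ Y₂ Z₂ * Z₁) (P₁ + P₂) := by
  have : CharP F 2 := charP_of_injective_algebraMap (algebraMap (ZMod 2) F).injective 2
  obtain ⟨hZ₁, hX₁, hY₁⟩ := h₁
  obtain ⟨hZ₂, hX₂, hY₂⟩ := h₂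
  rw [div_eq_iff hZ₁] at hX₁ hY₁
  rw [div_eq_iff hZ₂] at hX₂ hY₂
  subst hX₁ hY₁ hX₂ hY₂
  have hU := E.den_ne_zero P₁.x P₂.equation
  have hV := E.den_ne_zero P₁.y P₂.equation
  have hs : E.den P₁.y P₂.y P₂.x = E.den P₁.y P₂.x P₂.y := by
    unfold EdwardsCurve.den
    ring
  have h2 : (2 : F) = 0 := CharTwo.two_eq_zero
  simp only [projDen_mul, projNum_mul, hs]
  refine ⟨by simp [hU, hV, hZ₁, hZ₂], ?_, ?_⟩
  · change _ = E.num P₁.x P₁.y P₂.x P₂.y / E.den P₁.x P₂.x P₂.y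
    generalize E.den P₁.x P₂.x P₂.y = U at *
    generalize E.den P₁.y P₂.x P₂.y = V at *
    field_simp
    linear_combination P₁.y * U * h2
  · change _ = E.num P₁.y P₁.x P₂.y P₂.x / E.den P₁.y P₂.x P₂.y
    generalize E.den P₁.x P₂.x P₂.y = U at *
    generalize E.den P₁.y P₂.x P₂.y = V at *
    field_simp
    linear_combination P₁.x * V * h2

end Curve

/-! ### Work registers as ancilla qubits. -/

section Wires

variable {n a : ℕ}

/-- The ancilla qubits of the adder. -/
abbrev Ancilla (n a : ℕ) := (Fin 25 × Fin 3) × Fin n ⊕ Fin 25 × Fin a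

/-- The wires of the adder. -/
noncomputable def wiresEquiv (n a : ℕ) :
    Bank Reg (Fin 25) n a ≃ Wire 9 n (Fintype.card (Ancilla n a)) :=
  ((Equiv.sumCongr (Equiv.sumProdDistrib _ _ _) (Equiv.refl _)).trans (Equiv.sumAssoc _ _ _)).trans
    (Equiv.sumCongr (Equiv.refl _) (Fintype.equivFin _))

/-- Ancilla bits equal to 0 serve as work registers because the coordinates of the field element 0
vanish. -/
theorem encode_comp_wiresEquiv {F : Type*} [Field F] [Algebra (ZMod 2) F]
    (pb : PowerBasis (ZMod 2) F) (a : ℕ) (v : Fin 9 → F) :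
    encode pb _ v ∘ wiresEquiv pb.dim a = bankEncode pb (Fin 25) a (Sum.elim v 0) := by
  funext x
  rcases x with ⟨i | r, j⟩ | x
  · rfl
  · simp [wiresEquiv, bankEncode, encode]
  · rfl

end Wires

end EdwardsAdder

theorem mainTheorem3 :
    ∃ c : ℕ, ∀ (F : Type*) [Field F] [Algebra (ZMod 2) F] (pb : PowerBasis (ZMod 2) F)
      (E : EdwardsCurve F) (a : ℕ) (M : Circuit (Wire 3 pb.dim a)), IsMultiplier pb M →
      ∃ (a' : ℕ) (C : Circuit (Wire 9 pb.dim a')), IsPointAdder pb E C ∧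
        C.depth ≤ 5 * M.depth + 4 * max M.depth (2 * pb.dim) + c ∧
        C.tDepth ≤ 9 * M.tDepth ∧
        C.gateCount ≤ 39 * M.gateCount + (8 * pb.dim ^ 2 + c * pb.dim) ∧
        C.tCount = 39 * M.tCount ∧
        -- the summands that do not come from multipliers are due to CNOT gates only
        ∀ (w : OneQubit → ℕ) (wC : ℕ), (∀ u, w u.adj = w u) →
          C.span w wC ≤
            5 * M.span w wC + 4 * max (M.span w wC) (2 * pb.dim * wC) + c * wC ∧
          C.size w wC ≤ 39 * M.size w wC + (8 * pb.dim ^ 2 + c * pb.dim) * wC := by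
  -- There are 126 register additions, each of CNOT depth at most one and with `n` CNOT gates, so
  -- one constant serves both depth and size.
  refine ⟨126, fun F _ _ pb E a M hM => ?_⟩
  set B := fun c => LinearMap.toMatrix pb.basis pb.basis (EdwardsAdder.linearMaps E c)
  have he := (EdwardsAdder.wiresEquiv pb.dim a).injective
  set C := (RegOp.compile M B EdwardsAdder.program).relabel _ he
  have hspan (w : OneQubit → ℕ) (wC : ℕ) : C.span w wC ≤
      5 * M.span w wC + 4 * max (M.span w wC) (2 * pb.dim * wC) + 126 * wC := by
    refine ((Circuit.span_relabel_le w wC _ he _).trans (EdwardsAdder.span_program_le M B w wC)).trans ?_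
    gcongr
    -- The diagonals give depth `n` for linear maps, which is within the allowed `2n`.
    omega
  obtain ⟨k, hk, hsize⟩ := RegOp.size_compile M B EdwardsAdder.valid_program
  simp only [EdwardsAdder.counts_program] at hk hsize
  have hle (w : OneQubit → ℕ) (wC : ℕ) :
      C.size w wC ≤ 39 * M.size w wC + (8 * pb.dim ^ 2 + 126 * pb.dim) * wC := by
    rw [Circuit.size_relabel, hsize]
    gcongr
  refine ⟨_, C, ?_, ?_, ?_, ?_, ?_, fun w wC _ => ⟨hspan w wC, hle w wC⟩⟩
  · intro P₁ P₂ X₁ Y₁ Z₁ X₂ Y₂ Z₂ h₁ h₂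
    have : Module.Finite (ZMod 2) F := pb.finite
    refine ⟨_, _, _, EdwardsAdder.represents_add E h₁ h₂, ?_⟩
    rw [Circuit.run_relabel_ket _ he _ _ (bankEncode pb (Fin 25) a _)
      (by rw [EdwardsAdder.encode_comp_wiresEquiv, RegOp.run_compile pb hM _ EdwardsAdder.valid_program]),
      EdwardsAdder.foldl_program_dat, ← EdwardsAdder.encode_comp_wiresEquiv]
    congr 1
    funext x
    obtain ⟨y, rfl⟩ := (EdwardsAdder.wiresEquiv pb.dim a).surjective x
    rw [he.extend_apply]
    rfl
  · simpa [Circuit.depth] using hspan (fun _ => 1) 1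
  -- With CNOT gates of weight 0 the maximum is the multiplier's own `T`-depth, and `5 + 4 = 9`.
  · refine (hspan OneQubit.tWeight 0).trans (le_of_eq ?_)
    simp only [Circuit.tDepth, mul_zero, Nat.max_zero]
    ring
  · simpa [Circuit.gateCount_eq_size] using hle (fun _ => 1) 1
  · simp only [Circuit.tCount, C, Circuit.size_relabel, hsize, mul_zero, add_zero]
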